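/- Let $X_2$ be the space of real matrices $x=(x_{kn})_{k\in\{1,2\},\,n\in\mathbb Z}$ and, for $b_{kn}>0$ and $a_{kn}\in\mathbb R$, let $\mu=\mu^2_{(b,a)}=\bigotimes_{k=1}^{2}\bigotimes_{n\in\mathbb Z}\mu_{(b_{kn},a_{kn})}$ be the Gaussian product measure on $X_2$, where $d\mu_{(b,a)}(x)=(b/\pi)^{1/2}\exp(-b(x-a)^2)\,dx$ on $\mathbb R$. For a real $2\times2$ matrix $t$ let $L_t(x)=tx$ and let $\mu^{L_t}(\Delta)=\mu(L_t^{-1}(\Delta))$ be the image measure. Put $$\exp(tE_{12})=\begin{pmatrix}1&t\\0&1\end{pmatrix},\quad \exp(tE_{21})=\begin{pmatrix}1&0\\t&1\end{pmatrix},\quad P_1=\begin{pmatrix}-1&0\\0&1\end{pmatrix},\quad P_2=\begin{pmatrix}1&0\\0&-1\end{pmatrix},\quad \tau_-(\phi,s)=\begin{pmatrix}\cos\phi&s^2\sin\phi\\ s^{-2}\sin\phi&-\cos\phi\end{pmatrix},$$ and, with values in $[0,\infty]$ and $0\cdot\infty=0$, for $k\ne n$ in $\{1,2\}$, $$S^L_{kn}(\mu)=\sum_{m\in\mathbb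 Z}\frac{b_{km}}2\Big(\frac1{2b_{nm}}+a_{nm}^2\Big),\qquad S^{L,-}_{kn}(\mu,t)=\frac{t^2}4\sum_{m\in\mathbb Z}\frac{b_{km}}{b_{nm}}+\sum_{m\in\mathbb Z}\frac{b_{km}}2(-2a_{km}+ta_{nm})^2,$$ $$\Sigma^-_{12}(\tau_-(\phi,s))=\sin^2\phi\,\Sigma_1(s)+\Sigma_2^-(\tau_-(\phi,s)),\qquad \Sigma_1(s)=\sum_{n\in\mathbb Z}\Big(s^2\sqrt{\tfrac{b_{1n}}{b_{2n}}}-s^{-2}\sqrt{\tfrac{b_{2n}}{b_{1n}}}\Big)^2,$$ $$\Sigma_2^-(\tau_-(\phi,s))=\sum_{n\in\mathbb Z}\Big(4\sin^2\tfrac\phi2\,b_{1n}+4\cos^2\tfrac\phi2\,s^{-4}b_{2n}\Big)\Big(\sin\tfrac\phi2\,a_{1n}-s^2\cos\tfrac\phi2\,a_{2n}\Big)^2 .$$ Then the following three conditions are equivalent. (i) $\mu^{L_t}\perp\mu$ for all $t\in GL(2,\mathbb R)\setminus\{e\}$. (ii) (a) $\mu^{L_{\exp(tE_{12})}}\perp\mu$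 for all $t\in\mathbb R\setminus\{0\}$; (b) $\mu^{L_{\exp(tE_{21})}}\perp\mu$ for all $t\in\mathbb R\setminus\{0\}$; (c) $\mu^{L_{\exp(tE_{12})P_1}}\perp\mu$ for all $t\in\mathbb R$; (d) $\mu^{L_{\exp(tE_{21})P_2}}\perp\mu$ for all $t\in\mathbb R$; and (e) $\mu^{L_{\tau_-(\phi,s)}}\perp\mu$ for all $s>0$, $\phi\in[0,2\pi)$. (iii) (a) $S^L_{12}(\mu)=\infty$; (b) $S^L_{21}(\mu)=\infty$; (c) $S^{L,-}_{12}(\mu,t)=\infty$ for all $t\in\mathbb R$; (d) $S^{L,-}_{21}(\mu,t)=\infty$ for all $t\in\mathbb R$; and (e) $\Sigma^-_{12}(\tau_-(\phi,s))=\infty$ for all $s>0$, $\phi\in[0,2\pi)$. Moreover, (ii)($\sharp$) $\Leftrightarrow$ (iii)($\sharp$) for each $\sharp=a,b,c,d,e$, and these equivalences also hold for each single value of the parameter ($t\neq0$ in (a), (b); $t\in\mathbb R$ in (c), (d); $s>0$, $\phi\in[0,2\pi)$ in (e)). -/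

import Mathlib

open MeasureTheory ProbabilityTheory
open scoped ENNReal

namespace GaussLeft

/-- The space `X_m` of real matrices with `m` rows and columns indexed by `ℤ`
(with the product `σ`-algebra). -/
abbrev RowSpace (m : ℕ) : Type := Fin m → ℤ → ℝ

/-- The Gaussian measure on `ℝ` with density `(b/π)^{1/2} exp(-b (x-a)^2)`, `b > 0`:
it has mean `a` and variance `1/(2b)`. -/
noncomputable def gauss (b a : ℝ) : Measure ℝ :=
  gaussianReal a (Real.toNNReal (1 / (2 * b)))

instance (b a : ℝ) : IsProbabilityMeasure (gauss b a) := by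
  unfold gauss; infer_instance

theorem gauss_eq_withDensity {b : ℝ} (hb : 0 < b) (a : ℝ) :
    gauss b a = volume.withDensity
      (fun x => ENNReal.ofReal (Real.sqrt (b / Real.pi) * Real.exp (-b * (x - a) ^ 2))) := by
  have hv : (0 : ℝ) < 1 / (2 * b) := by positivity
  unfold gauss
  rw [gaussianReal_of_var_ne_zero _ (by simpa using hb)]
  congr 1
  funext x
  unfold gaussianPDF gaussianPDFReal
  rw [Real.coe_toNNReal _ hv.le, ← Real.sqrt_inv]
  congr 3
  · field_simp
  · field_simp

/-- The Gaussian product measure `μ_{(b,a)}^m = ⊗_{k} ⊗_{n ∈ ℤ} μ_{(b_{kn},a_{kn})}` on `X_m`. -/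
noncomputable def gaussMeasure {m : ℕ} (b a : Fin m → ℤ → ℝ) : Measure (RowSpace m) :=
  Measure.pi fun k => Measure.infinitePi fun n => gauss (b k n) (a k n)

/-- The left action `L_t x = t x`. -/
def leftMul {m : ℕ} (t : Matrix (Fin m) (Fin m) ℝ) (x : RowSpace m) : RowSpace m :=
  fun k n => ∑ r, t k r * x r n

theorem measurable_leftMul {m : ℕ} (t : Matrix (Fin m) (Fin m) ℝ) : Measurable (leftMul t) := by
  unfold leftMul
  fun_prop

/-- The image measure `μ^{L_t}(Δ) = μ(L_t⁻¹(Δ))`. -/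
noncomputable def leftImage {m : ℕ} (μ : Measure (RowSpace m)) (t : Matrix (Fin m) (Fin m) ℝ) :
    Measure (RowSpace m) :=
  μ.map (leftMul t)

/-- `exp(t E₁₂) = I + t E₁₂`. -/
def expE12 (t : ℝ) : Matrix (Fin 2) (Fin 2) ℝ := !![1, t; 0, 1]

/-- `exp(t E₂₁) = I + t E₂₁`. -/
def expE21 (t : ℝ) : Matrix (Fin 2) (Fin 2) ℝ := !![1, 0; t, 1]

def P1 : Matrix (Fin 2) (Fin 2) ℝ := !![-1, 0; 0, 1]

def P2 : Matrix (Fin 2) (Fin 2) ℝ := !![1, 0; 0, -1]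

/-- `τ₋(φ,s)`. -/
noncomputable def tauMinus (φ s : ℝ) : Matrix (Fin 2) (Fin 2) ℝ :=
  !![Real.cos φ, s ^ 2 * Real.sin φ; (s ^ 2)⁻¹ * Real.sin φ, -Real.cos φ]

/-! The series below have nonnegative terms; their sums are taken in `[0,∞]`, so that `= ⊤` means
divergence, and `0 * ⊤ = 0`. The row indices `1, 2` are `0, 1 : Fin 2`. -/

/-- `S^L_{kn}(μ) = ∑_m (b_{km}/2) (1/(2 b_{nm}) + a_{nm}²)`. -/
noncomputable def SL (b a : Fin 2 → ℤ → ℝ) (k n : Fin 2) : ℝ≥0∞ :=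
  ∑' m : ℤ, ENNReal.ofReal (b k m / 2 * (1 / (2 * b n m) + a n m ^ 2))

/-- `S^{L,-}_{kn}(μ,t) = (t²/4) ∑_m b_{km}/b_{nm} + ∑_m (b_{km}/2) (-2 a_{km} + t a_{nm})²`. -/
noncomputable def SLminus (b a : Fin 2 → ℤ → ℝ) (k n : Fin 2) (t : ℝ) : ℝ≥0∞ :=
  ENNReal.ofReal (t ^ 2 / 4) * ∑' m : ℤ, ENNReal.ofReal (b k m / b n m) +
    ∑' m : ℤ, ENNReal.ofReal (b k m / 2 * (-2 * a k m + t * a n m) ^ 2)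

/-- `Σ₁(s)`. -/
noncomputable def Sigma1 (b : Fin 2 → ℤ → ℝ) (s : ℝ) : ℝ≥0∞ :=
  ∑' n : ℤ, ENNReal.ofReal
    ((s ^ 2 * Real.sqrt (b 0 n / b 1 n) - (s ^ 2)⁻¹ * Real.sqrt (b 1 n / b 0 n)) ^ 2)

/-- `Σ₂⁻(τ₋(φ,s))`. -/
noncomputable def Sigma2minus (b a : Fin 2 → ℤ → ℝ) (φ s : ℝ) : ℝ≥0∞ :=
  ∑' n : ℤ, ENNReal.ofReal
    ((4 * Real.sin (φ / 2) ^ 2 * b 0 n + 4 * Real.cos (φ / 2) ^ 2 * (s ^ 4)⁻¹ * b 1 n) *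
      (Real.sin (φ / 2) * a 0 n - s ^ 2 * Real.cos (φ / 2) * a 1 n) ^ 2)

/-- `Σ₁₂⁻(τ₋(φ,s)) = sin² φ Σ₁(s) + Σ₂⁻(τ₋(φ,s))`. -/
noncomputable def Sigma12minus (b a : Fin 2 → ℤ → ℝ) (φ s : ℝ) : ℝ≥0∞ :=
  ENNReal.ofReal (Real.sin φ ^ 2) * Sigma1 b s + Sigma2minus b a φ s

end GaussLeft

/-! Read column by column, `μ` is a product over `n ∈ ℤ` of planar Gaussian laws, and `L_t` applies
the same matrix `t` to every column. By Kakutani's criterion `μ^{L_t} ⊥ μ` holds exactly when the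
product of the Hellinger affinities of the columns is zero.

The squared affinity of one column is `exp(-v) / (1 + u)`. Here `u` (`covDefect`) depends only on
the covariances, and `v ≥ 0` is the minimum over `z` of `β(z) + β(δ + t z)`, where `β` is the
diagonal form with the column's weights and `δ = t α - α` is the displacement of the mean. Hence
singularity means `∑ (u + v) = ∞`. Always `v ≤ β(δ)`; if `∑ u` converges, the weighted norm of `t`
is bounded uniformly in `n` and `β(δ)` is at most a constant times `v`. So singularity is equivalent
to `∑ u = ∞` or `∑ β(δ) = ∞` (`leftImage_mutuallySingular_iff`). For the five families these two
series are, up to positive factors, the ones in (iii).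

For a general invertible `t ≠ 1`, lower bounds on `u` independent of `n` make `∑ u` diverge unless
`|det t| = 1` and the diagonal entries are equal (`det t = 1`) or opposite (`det t = -1`). What
remains is in one of the five families, or has an off-diagonal product so negative in sign that `u`
stays away from `0`, or moves the means enough that `∑ b_{kn} a_{kn}² = ∞`, which is (c) or (d) at
`t = 0`, finishes the proof. -/

namespace GaussLeft

/-! ### Kakutani's criterion for infinite product measures -/

section ProductMeasures

variable {ι : Type*} {X : ι → Type*} [∀ i, MeasurableSpace (X i)]

theorem lintegral_infinitePi_prod (P : ∀ i, Measure (X i)) [∀ i, IsProbabilityMeasure (P i)]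
    {f : ∀ i, X i → ℝ≥0∞} (hf : ∀ i, Measurable (f i)) (F : Finset ι) :
    ∫⁻ x, ∏ i ∈ F, f i (x i) ∂(Measure.infinitePi P) = ∏ i ∈ F, ∫⁻ y, f i y ∂(P i) := by
  have hind : iIndepFun (fun i (x : ∀ i, X i) ↦ f i (x i)) (Measure.infinitePi P) :=
    iIndepFun_infinitePi (fun i ↦ hf i)
  rw [lintegral_prod_eq_prod_lintegral_of_indepFun F (fun i (x : ∀ i, X i) ↦ f i (x i)) hind
    (fun i ↦ (hf i).comp (measurable_pi_apply i))]
  refine Finset.prod_congr rfl fun i _ ↦ ?_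
  rw [← lintegral_map (hf i) (measurable_pi_apply i), Measure.infinitePi_map_eval]

variable {P Q : ∀ i, Measure (X i)} [∀ i, IsProbabilityMeasure (P i)]
  [∀ i, IsProbabilityMeasure (Q i)] {g : ∀ i, X i → ℝ≥0∞}

/-- On cylinders over a finite set of coordinates, the product of the `Q i` has the product of the
densities as its density with respect to the product of the `P i`. -/
theorem infinitePi_cylinder_eq_lintegral (hg : ∀ i, Measurable (g i))
    (hQ : ∀ i, Q i = (P i).withDensity (g i)) (F : Finset ι) {S : Set (∀ i : F, X i)}
    (hS : MeasurableSet S) :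
    Measure.infinitePi Q (cylinder F S) =
      ∫⁻ x in cylinder F S, ∏ i ∈ F, g i (x i) ∂(Measure.infinitePi P) := by
  have hG : Measurable fun x : ∀ i, X i ↦ ∏ i ∈ F, g i (x i) :=
    Finset.measurable_prod _ fun i _ ↦ (hg i).comp (measurable_pi_apply i)
  have key : Measure.pi (fun i : F ↦ Q i) =
      ((Measure.infinitePi P).withDensity fun x ↦ ∏ i ∈ F, g i (x i)).map F.restrict := by
    refine Measure.pi_eq fun s hs ↦ ?_
    rw [Measure.map_apply (F.measurable_restrict) (MeasurableSet.univ_pi hs),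
      withDensity_apply _ (F.measurable_restrict (MeasurableSet.univ_pi hs)),
      ← lintegral_indicator (F.measurable_restrict (MeasurableSet.univ_pi hs))]
    classical
    -- Extending the box by `univ` outside `F` makes its indicator a product over coordinates.
    let t : ∀ i, Set (X i) := fun i ↦ if h : i ∈ F then s ⟨i, h⟩ else Set.univ
    have ht : ∀ i, MeasurableSet (t i) := by
      intro i
      by_cases h : i ∈ F
      · simpa [t, h] using hs ⟨i, h⟩
      · simp [t, h]
    have hts : ∀ i : F, t i = s i := fun i ↦ by simp [t, i.2]
    have h1 : ∀ x : ∀ i, X i, (F.restrict ⁻¹' Set.univ.pi s).indicator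
        (fun x : ∀ i, X i ↦ ∏ i ∈ F, g i (x i)) x = ∏ i ∈ F, (t i).indicator (g i) (x i) := by
      intro x
      by_cases hx : ∀ i ∈ F, x i ∈ t i
      · rw [Set.indicator_of_mem]
        · exact Finset.prod_congr rfl fun i hi ↦ (Set.indicator_of_mem (hx i hi) _).symm
        · intro i _
          rw [← hts i]
          exact hx i i.2
      · rw [Set.indicator_of_notMem]
        · push Not at hx
          obtain ⟨i, hi, hxi⟩ := hx
          exact (Finset.prod_eq_zero hi (Set.indicator_of_notMem hxi _)).symm
        · intro hx'
          refine hx fun i hi ↦ ?_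
          have := hx' ⟨i, hi⟩ (Set.mem_univ _)
          rw [← hts ⟨i, hi⟩] at this
          exact this
    simp_rw [h1]
    rw [lintegral_infinitePi_prod P (fun i ↦ (hg i).indicator (ht i)), ← Finset.prod_coe_sort]
    refine Finset.prod_congr rfl fun i _ ↦ ?_
    rw [lintegral_indicator (ht i), hQ i, withDensity_apply _ (hs i), hts i]
  rw [Measure.infinitePi_cylinder Q hS, key, Measure.map_apply F.measurable_restrict hS,
    withDensity_apply _ (F.measurable_restrict hS)]
  rfl

theorem setLIntegral_rpow_half_le {Ω : Type*} [MeasurableSpace Ω] (m : Measure Ω)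
    {G : Ω → ℝ≥0∞} (hG : Measurable G) (t : Set Ω) :
    ∫⁻ x in t, G x ^ (1 / 2 : ℝ) ∂m ≤ m t ^ (1 / 2 : ℝ) * (∫⁻ x in t, G x ∂m) ^ (1 / 2 : ℝ) := by
  have h := ENNReal.lintegral_mul_le_Lp_mul_Lq (m.restrict t)
    (Real.HolderConjugate.two_two) (f := fun _ ↦ 1) (g := fun x ↦ G x ^ (1 / 2 : ℝ))
    aemeasurable_const (hG.pow_const _).aemeasurable
  have e : ∀ x, (G x ^ (1 / 2 : ℝ)) ^ (2 : ℝ) = G x := fun x ↦ by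
    rw [← ENNReal.rpow_mul]; norm_num
  simp only [e] at h
  simpa using h

theorem prod_lintegral_rpow_half_eq (P : ∀ i, Measure (X i)) [∀ i, IsProbabilityMeasure (P i)]
    (hg : ∀ i, Measurable (g i)) (F : Finset ι) :
    ∏ i ∈ F, ∫⁻ y, g i y ^ (1 / 2 : ℝ) ∂(P i) =
      ∫⁻ x, (∏ i ∈ F, g i (x i)) ^ (1 / 2 : ℝ) ∂(Measure.infinitePi P) := by
  rw [← lintegral_infinitePi_prod P (fun i ↦ (hg i).pow_const _)]
  simp_rw [ENNReal.prod_rpow_of_nonneg (show (0 : ℝ) ≤ 1 / 2 by norm_num)]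

/-- Let `G` be the density over the coordinates in `F`. A measure `ξ` below both products satisfies
`ξ ≤ ∫ G ≤ ∫ √G` on `{G ≤ 1}` and `ξ ≤ ∫ 1 ≤ ∫ √G` on the complement, so its mass is at most twice
every finite product of affinities. -/
theorem infinitePi_mutuallySingular_of_iInf_eq_zero (hg : ∀ i, Measurable (g i))
    (hQ : ∀ i, Q i = (P i).withDensity (g i))
    (h : ⨅ F : Finset ι, ∏ i ∈ F, ∫⁻ y, g i y ^ (1 / 2 : ℝ) ∂(P i) = 0) :
    (Measure.infinitePi P).MutuallySingular (Measure.infinitePi Q) := by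
  rw [Measure.mutuallySingular_iff_disjoint]
  intro ξ hξP hξQ
  have hle : ∀ F : Finset ι,
      ξ Set.univ ≤ 2 * ∏ i ∈ F, ∫⁻ y, g i y ^ (1 / 2 : ℝ) ∂(P i) := by
    intro F
    rw [prod_lintegral_rpow_half_eq P hg F]
    have hG' : Measurable fun x : ∀ i : F, X i ↦ ∏ i : F, g i (x i) :=
      Finset.measurable_prod _ fun i _ ↦ (hg i).comp (measurable_pi_apply i)
    let S : Set (∀ i : F, X i) := {x | ∏ i : F, g i (x i) ≤ 1}
    have hS : MeasurableSet S := measurableSet_le hG' measurable_const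
    have hA : MeasurableSet (cylinder F S) := F.measurable_restrict hS
    have hmem : ∀ x : ∀ i, X i, x ∈ cylinder F S ↔ ∏ i ∈ F, g i (x i) ≤ 1 := by
      intro x
      rw [← Finset.prod_coe_sort F (fun i ↦ g i (x i))]
      rfl
    have h1 : ξ (cylinder F S) ≤
        ∫⁻ x, (∏ i ∈ F, g i (x i)) ^ (1 / 2 : ℝ) ∂(Measure.infinitePi P) := by
      refine (hξQ _).trans ?_
      rw [infinitePi_cylinder_eq_lintegral hg hQ F hS]
      refine (setLIntegral_mono' hA fun x hx ↦ ?_).trans (setLIntegral_le_lintegral _ _)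
      conv_lhs => rw [← ENNReal.rpow_one (∏ i ∈ F, g i (x i))]
      exact ENNReal.rpow_le_rpow_of_exponent_ge ((hmem x).1 hx) (by norm_num)
    have h2 : ξ (cylinder F S)ᶜ ≤
        ∫⁻ x, (∏ i ∈ F, g i (x i)) ^ (1 / 2 : ℝ) ∂(Measure.infinitePi P) := by
      refine (hξP _).trans ?_
      rw [← setLIntegral_one]
      refine (setLIntegral_mono' hA.compl fun x hx ↦ ?_).trans (setLIntegral_le_lintegral _ _)
      have hx' : 1 ≤ ∏ i ∈ F, g i (x i) := le_of_lt (not_le.1 fun hc ↦ hx ((hmem x).2 hc))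
      exact ENNReal.one_le_rpow hx' (by norm_num)
    rw [← measure_add_measure_compl hA, two_mul]
    exact add_le_add h1 h2
  have h0 : ξ Set.univ ≤ 0 := by
    have h3 : ξ Set.univ ≤ ⨅ F : Finset ι, 2 * ∏ i ∈ F, ∫⁻ y, g i y ^ (1 / 2 : ℝ) ∂(P i) :=
      le_iInf hle
    rwa [← ENNReal.mul_iInf_of_ne (by norm_num) (by norm_num), h, mul_zero] at h3
  rw [Measure.measure_univ_eq_zero.1 (nonpos_iff_eq_zero.1 h0)]
  exact bot_le

/-- A separating set is approximated by a cylinder that is nearly null for `P` and whose complement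
is nearly null for `Q`. Cauchy–Schwarz on each of the two pieces then bounds `∫ √G` by `2 √ε`. -/
theorem iInf_eq_zero_of_infinitePi_mutuallySingular (hg : ∀ i, Measurable (g i))
    (hQ : ∀ i, Q i = (P i).withDensity (g i))
    (h : (Measure.infinitePi P).MutuallySingular (Measure.infinitePi Q)) :
    ⨅ F : Finset ι, ∏ i ∈ F, ∫⁻ y, g i y ^ (1 / 2 : ℝ) ∂(P i) = 0 := by
  have main : ∀ ε : ℝ, 0 < ε → ⨅ F : Finset ι, ∏ i ∈ F, ∫⁻ y, g i y ^ (1 / 2 : ℝ) ∂(P i) ≤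
      2 * ENNReal.ofReal ε ^ (1 / 2 : ℝ) := by
    intro ε hε
    obtain ⟨s, hs, hPs, hQs⟩ := h
    -- Density is taken with respect to the sum, so that one cylinder is good for both measures.
    have dense : (Measure.infinitePi P + Measure.infinitePi Q).MeasureDense
        (measurableCylinders X) :=
      Measure.MeasureDense.of_generateFrom_isSetAlgebra_finite _ isSetAlgebra_measurableCylinders
        generateFrom_measurableCylinders.symm
    obtain ⟨t, ht, htε⟩ := dense.approx s hs (measure_ne_top _ _) ε hε
    obtain ⟨F, S, hS, rfl⟩ := (mem_measurableCylinders t).1 ht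
    have hA : MeasurableSet (cylinder F S) := F.measurable_restrict hS
    have hG : Measurable fun x : ∀ i, X i ↦ ∏ i ∈ F, g i (x i) :=
      Finset.measurable_prod _ fun i _ ↦ (hg i).comp (measurable_pi_apply i)
    rw [Measure.add_apply] at htε
    have hPt : Measure.infinitePi P (cylinder F S) ≤ ENNReal.ofReal ε := by
      refine (measure_mono (t := s ∪ symmDiff s (cylinder F S)) fun x hx ↦ ?_).trans
        ((measure_union_le _ _).trans ?_)
      · by_cases hxs : x ∈ s
        · exact Or.inl hxs
        · exact Or.inr (Or.inr ⟨hx, hxs⟩)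
      · rw [hPs, zero_add]
        exact (le_self_add.trans_lt htε).le
    have hQt : Measure.infinitePi Q (cylinder F S)ᶜ ≤ ENNReal.ofReal ε := by
      refine (measure_mono (t := sᶜ ∪ symmDiff s (cylinder F S)) fun x hx ↦ ?_).trans
        ((measure_union_le _ _).trans ?_)
      · by_cases hxs : x ∈ s
        · exact Or.inr (Or.inl ⟨hxs, hx⟩)
        · exact Or.inl hxs
      · rw [hQs, zero_add]
        exact (le_add_self.trans_lt htε).le
    refine (iInf_le _ F).trans ?_
    rw [prod_lintegral_rpow_half_eq P hg F, ← lintegral_add_compl _ hA, two_mul]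
    refine add_le_add ?_ ?_
    · refine (setLIntegral_rpow_half_le _ hG _).trans ?_
      rw [← infinitePi_cylinder_eq_lintegral hg hQ F hS]
      calc _ ≤ ENNReal.ofReal ε ^ (1 / 2 : ℝ) * 1 := by
            gcongr
            exact ENNReal.rpow_le_one prob_le_one (by norm_num)
        _ = _ := mul_one _
    · refine (setLIntegral_rpow_half_le _ hG _).trans ?_
      have hc := infinitePi_cylinder_eq_lintegral hg hQ F hS.compl
      rw [show cylinder F Sᶜ = (cylinder F S)ᶜ from rfl] at hc
      rw [← hc]
      calc _ ≤ 1 * ENNReal.ofReal ε ^ (1 / 2 : ℝ) := by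
            gcongr
            exact ENNReal.rpow_le_one prob_le_one (by norm_num)
        _ = _ := one_mul _
  rw [← nonpos_iff_eq_zero]
  refine ENNReal.le_of_forall_pos_le_add fun δ hδ _ ↦ ?_
  have hδ' : (0 : ℝ) < (δ : ℝ) / 2 := by positivity
  refine (main (((δ : ℝ) / 2) ^ 2) (by positivity)).trans ?_
  rw [ENNReal.ofReal_rpow_of_nonneg (by positivity) (by norm_num), ← Real.sqrt_eq_rpow,
    Real.sqrt_sq hδ'.le, zero_add, ← ENNReal.ofReal_coe_nnreal, ← ENNReal.ofReal_ofNat 2,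
    ← ENNReal.ofReal_mul (by norm_num)]
  apply ENNReal.ofReal_le_ofReal
  linarith

/-- Kakutani's criterion for singularity of two product measures. -/
theorem infinitePi_mutuallySingular_iff (hg : ∀ i, Measurable (g i))
    (hQ : ∀ i, Q i = (P i).withDensity (g i)) :
    (Measure.infinitePi P).MutuallySingular (Measure.infinitePi Q) ↔
      ⨅ F : Finset ι, ∏ i ∈ F, ∫⁻ y, g i y ^ (1 / 2 : ℝ) ∂(P i) = 0 :=
  ⟨iInf_eq_zero_of_infinitePi_mutuallySingular hg hQ,
    infinitePi_mutuallySingular_of_iInf_eq_zero hg hQ⟩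

end ProductMeasures

/-! ### Planar Gaussian integrals and densities -/

section PlanarGaussian

theorem lintegral_exp_neg_mul_add_sq {c : ℝ} (hc : 0 < c) (k : ℝ) :
    ∫⁻ x : ℝ, ENNReal.ofReal (Real.exp (-c * (x + k) ^ 2)) =
      ENNReal.ofReal (Real.sqrt (Real.pi / c)) := by
  rw [lintegral_add_right_eq_self (fun x : ℝ ↦ ENNReal.ofReal (Real.exp (-c * x ^ 2))) k,
    ← ofReal_integral_eq_lintegral_ofReal (integrable_exp_neg_mul_sq hc)
      (ae_of_all _ fun x ↦ (Real.exp_pos _).le), integral_gaussian]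

theorem lintegral_exp_neg_quadratic {A B C : ℝ} (hC : 0 < C) (hD : 0 < A * C - B ^ 2) :
    ∫⁻ z : Fin 2 → ℝ,
        ENNReal.ofReal (Real.exp (-(A * z 0 ^ 2 + 2 * B * z 0 * z 1 + C * z 1 ^ 2))) =
      ENNReal.ofReal (Real.pi / Real.sqrt (A * C - B ^ 2)) := by
  have hE : 0 < (A * C - B ^ 2) / C := div_pos hD hC
  have h1 := (volume_preserving_finTwoArrow ℝ).lintegral_comp
    (f := fun p : ℝ × ℝ ↦ ENNReal.ofReal
      (Real.exp (-(A * p.1 ^ 2 + 2 * B * p.1 * p.2 + C * p.2 ^ 2)))) (by fun_prop)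
  refine Eq.trans h1 ?_
  rw [Measure.volume_eq_prod, lintegral_prod _ (by fun_prop)]
  -- Completing the square in `y`; the shift `x + 0` only matches the form of the one-dimensional
  -- integral.
  have h2 : ∀ x y : ℝ, ENNReal.ofReal
      (Real.exp (-(A * x ^ 2 + 2 * B * x * y + C * y ^ 2))) =
      ENNReal.ofReal (Real.exp (-((A * C - B ^ 2) / C) * (x + 0) ^ 2)) *
        ENNReal.ofReal (Real.exp (-C * (y + B * x / C) ^ 2)) := by
    intro x y
    rw [← ENNReal.ofReal_mul (Real.exp_pos _).le, ← Real.exp_add]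
    congr 2
    field_simp
    ring
  simp_rw [h2]
  have h3 : ∀ x : ℝ, ∫⁻ y : ℝ,
      ENNReal.ofReal (Real.exp (-((A * C - B ^ 2) / C) * (x + 0) ^ 2)) *
        ENNReal.ofReal (Real.exp (-C * (y + B * x / C) ^ 2)) =
      ENNReal.ofReal (Real.exp (-((A * C - B ^ 2) / C) * (x + 0) ^ 2)) *
        ENNReal.ofReal (Real.sqrt (Real.pi / C)) := by
    intro x
    rw [lintegral_const_mul _ (by fun_prop), lintegral_exp_neg_mul_add_sq hC]
  simp_rw [h3]
  rw [lintegral_mul_const _ (by fun_prop), lintegral_exp_neg_mul_add_sq hE,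
    ← ENNReal.ofReal_mul (Real.sqrt_nonneg _), ← Real.sqrt_mul (by positivity)]
  congr 1
  rw [show Real.pi / ((A * C - B ^ 2) / C) * (Real.pi / C) = Real.pi ^ 2 / (A * C - B ^ 2) by
    field_simp, Real.sqrt_div (by positivity), Real.sqrt_sq Real.pi_pos.le]

/-- The law of one column `(x_{1n}, x_{2n})`. -/
noncomputable def columnGauss (β α : Fin 2 → ℝ) : Measure (Fin 2 → ℝ) :=
  Measure.pi fun k ↦ gauss (β k) (α k)

instance (β α : Fin 2 → ℝ) : IsProbabilityMeasure (columnGauss β α) := by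
  unfold columnGauss; infer_instance

/-- The quadratic form `β₁ x₁² + β₂ x₂²`. -/
def diagForm (β x : Fin 2 → ℝ) : ℝ := β 0 * x 0 ^ 2 + β 1 * x 1 ^ 2

@[fun_prop]
theorem continuous_diagForm (β : Fin 2 → ℝ) : Continuous (diagForm β) := by
  unfold diagForm; fun_prop

@[fun_prop]
theorem measurable_diagForm (β : Fin 2 → ℝ) : Measurable (diagForm β) :=
  (continuous_diagForm β).measurable

theorem diagForm_nonneg {β : Fin 2 → ℝ} (hβ : ∀ k, 0 < β k) (x : Fin 2 → ℝ) :
    0 ≤ diagForm β x := by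
  have := hβ 0
  have := hβ 1
  unfold diagForm
  positivity

theorem map_withDensity_comp {Ω Ω' : Type*} [MeasurableSpace Ω] [MeasurableSpace Ω']
    (m : Measure Ω) {T : Ω → Ω'} (hT : Measurable T) {f : Ω' → ℝ≥0∞} (hf : Measurable f) :
    (m.withDensity (f ∘ T)).map T = (m.map T).withDensity f := by
  ext s hs
  rw [Measure.map_apply hT hs, withDensity_apply _ (hT hs), withDensity_apply _ hs,
    setLIntegral_map hs hf hT]
  rfl

theorem columnGauss_eq_withDensity {β : Fin 2 → ℝ} (hβ : ∀ k, 0 < β k) (α : Fin 2 → ℝ) :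
    columnGauss β α = volume.withDensity fun x ↦
      ENNReal.ofReal (Real.sqrt (β 0 * β 1) / Real.pi * Real.exp (-diagForm β (x - α))) := by
  have h1 := (measurePreserving_finTwoArrow_vec (gauss (β 0) (α 0)) (gauss (β 1) (α 1))).symm.map_eq
  have h2 := (volume_preserving_finTwoArrow ℝ).symm.map_eq
  have h3 : columnGauss β α =
      Measure.pi ![gauss (β 0) (α 0), gauss (β 1) (α 1)] := by
    unfold columnGauss
    congr 1
    funext k
    fin_cases k <;> rfl
  rw [h3, ← h1, gauss_eq_withDensity (hβ 0), gauss_eq_withDensity (hβ 1),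
    prod_withDensity (by fun_prop) (by fun_prop), ← h2,
    ← map_withDensity_comp _ (MeasurableEquiv.measurable _) (by fun_prop)]
  congr 2
  funext p
  have hs : Real.sqrt (β 0 * β 1) / Real.pi =
      Real.sqrt (β 0 / Real.pi) * Real.sqrt (β 1 / Real.pi) := by
    have := hβ 0
    rw [← Real.sqrt_mul (by positivity), show β 0 / Real.pi * (β 1 / Real.pi) =
      β 0 * β 1 / Real.pi ^ 2 by field_simp, Real.sqrt_div' _ (by positivity),
      Real.sqrt_sq Real.pi_pos.le]
  rw [← ENNReal.ofReal_mul (by positivity), hs]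
  simp only [Function.comp, diagForm, Pi.sub_apply]
  congr 1
  rw [mul_mul_mul_comm, ← Real.exp_add]
  congr 2
  simp [MeasurableEquiv.finTwoArrow]
  ring

variable {β : Fin 2 → ℝ} (α : Fin 2 → ℝ) {t : Matrix (Fin 2) (Fin 2) ℝ}

@[fun_prop]
theorem measurable_mulVec (t : Matrix (Fin 2) (Fin 2) ℝ) : Measurable t.mulVec := by
  have : Continuous t.mulVec := by fun_prop
  exact this.measurable

/-- The density of a planar Gaussian law with respect to its image under `t`. -/
noncomputable def columnDensity (β α : Fin 2 → ℝ) (t : Matrix (Fin 2) (Fin 2) ℝ)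
    (x : Fin 2 → ℝ) : ℝ≥0∞ :=
  ENNReal.ofReal (|t.det| * Real.exp (diagForm β (t⁻¹.mulVec x - α) - diagForm β (x - α)))

@[fun_prop]
theorem measurable_columnDensity (β α : Fin 2 → ℝ) (t : Matrix (Fin 2) (Fin 2) ℝ) :
    Measurable (columnDensity β α t) := by
  unfold columnDensity; fun_prop

theorem inv_mulVec_mulVec (ht : t.det ≠ 0) (y : Fin 2 → ℝ) : t⁻¹.mulVec (t.mulVec y) = y := by
  rw [Matrix.mulVec_mulVec, Matrix.nonsing_inv_mul _ (Ne.isUnit ht), Matrix.one_mulVec]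

/-- The image law is the reference measure, so that pulling integrals back along `t` later cancels
`t⁻¹` in the density. -/
theorem columnGauss_eq_map_withDensity (hβ : ∀ k, 0 < β k) (ht : t.det ≠ 0) :
    columnGauss β α =
      ((columnGauss β α).map t.mulVec).withDensity (columnDensity β α t) := by
  have hmap : (volume : Measure (Fin 2 → ℝ)).map t.mulVec =
      ENNReal.ofReal |t.det⁻¹| • volume := by
    have := Real.map_matrix_volume_pi_eq_smul_volume_pi ht
    rwa [show (⇑(Matrix.toLin' t)) = t.mulVec from rfl] at this
  set p : (Fin 2 → ℝ) → ℝ≥0∞ := fun x ↦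
      ENNReal.ofReal (Real.sqrt (β 0 * β 1) / Real.pi * Real.exp (-diagForm β (x - α))) with hp
  have hpm : Measurable p := by fun_prop
  have h1 : p = (p ∘ t⁻¹.mulVec) ∘ t.mulVec := by
    funext y
    simp only [Function.comp, inv_mulVec_mulVec ht]
  conv_rhs => rw [columnGauss_eq_withDensity hβ, ← hp, h1,
    map_withDensity_comp _ (by fun_prop) (by fun_prop), hmap]
  rw [withDensity_smul_measure, withDensity_smul_measure,
    ← withDensity_mul _ (by fun_prop) (by fun_prop), ← withDensity_smul _ (by fun_prop),
    columnGauss_eq_withDensity hβ]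
  congr 1
  funext x
  have h0 : 0 < |t.det| := abs_pos.2 ht
  simp only [Pi.smul_apply, Pi.mul_apply, Function.comp, smul_eq_mul, hp, columnDensity]
  rw [← ENNReal.ofReal_mul (by positivity), ← ENNReal.ofReal_mul (by positivity), abs_inv]
  congr 1
  rw [sub_eq_add_neg (diagForm β (t⁻¹.mulVec x - α)), Real.exp_add]
  have h2 : Real.exp (-diagForm β (t⁻¹.mulVec x - α)) * Real.exp (diagForm β (t⁻¹.mulVec x - α))
      = 1 := by rw [← Real.exp_add]; simp
  calc _ = (|t.det|⁻¹ * |t.det|) * (Real.sqrt (β 0 * β 1) / Real.pi *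
        ((Real.exp (-diagForm β (t⁻¹.mulVec x - α)) *
          Real.exp (diagForm β (t⁻¹.mulVec x - α))) * Real.exp (-diagForm β (x - α)))) := by
        rw [h2, inv_mul_cancel₀ h0.ne']; ring
    _ = _ := by ring

theorem lintegral_columnDensity_rpow_half (hβ : ∀ k, 0 < β k) (ht : t.det ≠ 0) :
    ∫⁻ x, columnDensity β α t x ^ (1 / 2 : ℝ) ∂((columnGauss β α).map t.mulVec) =
      ENNReal.ofReal (Real.sqrt (|t.det| * (β 0 * β 1)) / Real.pi) *
      ∫⁻ z : Fin 2 → ℝ, ENNReal.ofReal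
        (Real.exp (-((diagForm β z + diagForm β (t.mulVec α - α + t.mulVec z)) / 2))) := by
  rw [lintegral_map (by fun_prop) (by fun_prop), columnGauss_eq_withDensity hβ,
    lintegral_withDensity_eq_lintegral_mul _ (by fun_prop) (by fun_prop),
    ← lintegral_const_mul _ (by fun_prop), ← lintegral_add_right_eq_self _ α]
  congr 1
  funext z
  simp only [Pi.mul_apply, columnDensity, inv_mulVec_mulVec ht, add_sub_cancel_right]
  rw [ENNReal.ofReal_rpow_of_nonneg (by positivity) (by norm_num),
    ← ENNReal.ofReal_mul (by positivity), ← ENNReal.ofReal_mul (by positivity), ← Real.sqrt_eq_rpow, Real.sqrt_mul (abs_nonneg _),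
    Real.sqrt_mul (abs_nonneg _), ← Real.exp_half, Matrix.mulVec_add,
    show t.mulVec z + t.mulVec α - α = t.mulVec α - α + t.mulVec z by abel]
  congr 1
  rw [show -((diagForm β z + diagForm β (t.mulVec α - α + t.mulVec z)) / 2) =
    -diagForm β z + (diagForm β z - diagForm β (t.mulVec α - α + t.mulVec z)) / 2 by ring,
    Real.exp_add]
  ring

end PlanarGaussian

/-! ### Hellinger affinity of one column -/

section Affinity

variable {β : Fin 2 → ℝ} {t : Matrix (Fin 2) (Fin 2) ℝ}

/-- The squared Frobenius norm of `t` conjugated by the square root of `diag(β₁, β₂)`. -/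
noncomputable def weightedNormSq (β : Fin 2 → ℝ) (t : Matrix (Fin 2) (Fin 2) ℝ) : ℝ :=
  t 0 0 ^ 2 + t 1 1 ^ 2 + t 0 1 ^ 2 * (β 0 / β 1) + t 1 0 ^ 2 * (β 1 / β 0)

/-- The contribution of the covariances to the distance of a planar Gaussian law from its image. -/
noncomputable def covDefect (β : Fin 2 → ℝ) (t : Matrix (Fin 2) (Fin 2) ℝ) : ℝ :=
  (1 + t.det ^ 2 + weightedNormSq β t) / (4 * |t.det|) - 1

theorem weightedNormSq_nonneg (hβ : ∀ k, 0 < β k) (t : Matrix (Fin 2) (Fin 2) ℝ) :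
    0 ≤ weightedNormSq β t := by
  have := hβ 0
  have := hβ 1
  unfold weightedNormSq
  positivity

/-- Conjugation by the square root of `diag(β₁, β₂)` preserves the determinant, and for a 2×2 matrix
the squared Frobenius norm plus or minus twice the determinant is a sum of two squares. -/
theorem two_abs_det_le_weightedNormSq (hβ : ∀ k, 0 < β k) (t : Matrix (Fin 2) (Fin 2) ℝ) :
    2 * |t.det| ≤ weightedNormSq β t := by
  have h0 := hβ 0
  have h1 := hβ 1
  set r := Real.sqrt (β 0 / β 1) with hr
  have hr0 : 0 < r := Real.sqrt_pos.2 (by positivity)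
  have hrr : β 0 / β 1 = r ^ 2 := (Real.sq_sqrt (by positivity)).symm
  have hrr' : β 1 / β 0 = (r⁻¹) ^ 2 := by rw [← inv_div, hrr, inv_pow]
  have hc : r * r⁻¹ = 1 := mul_inv_cancel₀ hr0.ne'
  have hx : t 0 1 * t 1 0 = (t 0 1 * r) * (t 1 0 * r⁻¹) := by
    rw [mul_mul_mul_comm, hc, mul_one]
  have e : weightedNormSq β t =
      t 0 0 ^ 2 + t 1 1 ^ 2 + (t 0 1 * r) ^ 2 + (t 1 0 * r⁻¹) ^ 2 := by
    unfold weightedNormSq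
    rw [hrr, hrr']
    ring
  rw [e, Matrix.det_fin_two, hx, ← abs_two, ← abs_mul, abs_le]
  constructor
  · nlinarith [sq_nonneg (t 0 0 + t 1 1), sq_nonneg (t 0 1 * r - t 1 0 * r⁻¹)]
  · nlinarith [sq_nonneg (t 0 0 - t 1 1), sq_nonneg (t 0 1 * r + t 1 0 * r⁻¹)]

theorem sq_one_sub_abs_det_le_covDefect (hβ : ∀ k, 0 < β k) (ht : t.det ≠ 0) :
    (1 - |t.det|) ^ 2 / (4 * |t.det|) ≤ covDefect β t := by
  have hd : 0 < |t.det| := abs_pos.2 ht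
  have h := two_abs_det_le_weightedNormSq hβ t
  unfold covDefect
  rw [le_sub_iff_add_le, div_add_one (by positivity), ← sq_abs t.det]
  refine div_le_div_of_nonneg_right ?_ (by positivity)
  linarith

theorem covDefect_nonneg (hβ : ∀ k, 0 < β k) (ht : t.det ≠ 0) : 0 ≤ covDefect β t :=
  le_trans (by positivity) (sq_one_sub_abs_det_le_covDefect hβ ht)

theorem weightedNormSq_le_covDefect (ht : t.det ≠ 0) :
    weightedNormSq β t ≤ 4 * |t.det| * (1 + covDefect β t) := by
  have hd : 0 < |t.det| := abs_pos.2 ht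
  unfold covDefect
  rw [add_sub_cancel, mul_div_cancel₀ _ (by positivity)]
  nlinarith [sq_nonneg t.det]

/-- The operator norm is at most the Frobenius norm, in the inner product given by `β`; the defect
is an explicit sum of squares. -/
theorem diagForm_mulVec_le (hβ : ∀ k, 0 < β k) (t : Matrix (Fin 2) (Fin 2) ℝ) (z : Fin 2 → ℝ) :
    diagForm β (t.mulVec z) ≤ weightedNormSq β t * diagForm β z := by
  have h0 := hβ 0
  have h1 := hβ 1
  have e : weightedNormSq β t * diagForm β z - diagForm β (t.mulVec z) =
      (t 0 0 * β 1 * z 1 - t 0 1 * β 0 * z 0) ^ 2 / β 1 +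
        (t 1 1 * β 0 * z 0 - t 1 0 * β 1 * z 1) ^ 2 / β 0 := by
    unfold weightedNormSq diagForm
    simp only [Matrix.mulVec, dotProduct, Fin.sum_univ_two]
    field_simp
    ring
  have : 0 ≤ weightedNormSq β t * diagForm β z - diagForm β (t.mulVec z) := by
    rw [e]; positivity
  linarith

theorem diagForm_sub_le (hβ : ∀ k, 0 < β k) (x y : Fin 2 → ℝ) :
    diagForm β (x - y) ≤ 2 * diagForm β x + 2 * diagForm β y := by
  have h := diagForm_nonneg hβ (x + y)
  simp only [diagForm, Pi.sub_apply, Pi.add_apply] at *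
  nlinarith

/-- The Hellinger affinity of a planar Gaussian law and its image under `t`. -/
theorem exists_columnAffinity_eq (hβ : ∀ k, 0 < β k) (α : Fin 2 → ℝ) (ht : t.det ≠ 0) :
    ∃ v : ℝ, 0 ≤ v ∧ v ≤ diagForm β (t.mulVec α - α) ∧
      diagForm β (t.mulVec α - α) ≤ 2 * (1 + weightedNormSq β t) * v ∧
      ∫⁻ x, columnDensity β α t x ^ (1 / 2 : ℝ) ∂((columnGauss β α).map t.mulVec) =
        ENNReal.ofReal (Real.sqrt (Real.exp (-v) / (1 + covDefect β t))) := by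
  have h0 := hβ 0
  have h1 := hβ 1
  have hd : 0 < |t.det| := abs_pos.2 ht
  set δ := t.mulVec α - α with hδ
  -- `A`, `B`, `C` are the coefficients of the quadratic part of `(β(z) + β(δ + t z)) / 2`; below,
  -- `2 l₀` and `2 l₁` are those of its linear part, and `z` is its critical point.
  set A := (β 0 + β 0 * t 0 0 ^ 2 + β 1 * t 1 0 ^ 2) / 2 with hA
  set B := (β 0 * t 0 0 * t 0 1 + β 1 * t 1 0 * t 1 1) / 2 with hB
  set C := (β 1 + β 0 * t 0 1 ^ 2 + β 1 * t 1 1 ^ 2) / 2 with hC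
  have hA0 : 0 < A := by positivity
  have hC0 : 0 < C := by positivity
  have hu := covDefect_nonneg hβ ht
  have hD : A * C - B ^ 2 = |t.det| * (β 0 * β 1) * (1 + covDefect β t) := by
    have : |t.det| * (1 + covDefect β t) = (1 + t.det ^ 2 + weightedNormSq β t) / 4 := by
      unfold covDefect
      field_simp
      ring
    rw [mul_right_comm, this, Matrix.det_fin_two]
    unfold weightedNormSq
    field_simp
    rw [hA, hB, hC]
    ring
  have hD0 : 0 < A * C - B ^ 2 := by rw [hD]; positivity
  set l₀ := (β 0 * δ 0 * t 0 0 + β 1 * δ 1 * t 1 0) / 2 with hl₀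
  set l₁ := (β 0 * δ 0 * t 0 1 + β 1 * δ 1 * t 1 1) / 2 with hl₁
  set z : Fin 2 → ℝ := ![-((C * l₀ - B * l₁) / (A * C - B ^ 2)),
    -((A * l₁ - B * l₀) / (A * C - B ^ 2))] with hz
  have hz0 : A * z 0 + B * z 1 + l₀ = 0 := by
    simp only [hz, Matrix.cons_val_zero, Matrix.cons_val_one]
    field_simp
    ring
  have hz1 : B * z 0 + C * z 1 + l₁ = 0 := by
    simp only [hz, Matrix.cons_val_zero, Matrix.cons_val_one]
    have e : B * -((C * l₀ - B * l₁) / (A * C - B ^ 2)) +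
        C * -((A * l₁ - B * l₀) / (A * C - B ^ 2)) + l₁ =
        l₁ * (1 - (A * C - B ^ 2) / (A * C - B ^ 2)) := by ring
    rw [e, div_self hD0.ne', sub_self, mul_zero]
  have key : ∀ w : Fin 2 → ℝ, (diagForm β (w + z) + diagForm β (δ + t.mulVec (w + z))) / 2 =
      A * w 0 ^ 2 + 2 * B * w 0 * w 1 + C * w 1 ^ 2 +
        (diagForm β z + diagForm β (δ + t.mulVec z)) / 2 := by
    intro w
    have e : (diagForm β (w + z) + diagForm β (δ + t.mulVec (w + z))) / 2 =
      A * w 0 ^ 2 + 2 * B * w 0 * w 1 + C * w 1 ^ 2 +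
        (diagForm β z + diagForm β (δ + t.mulVec z)) / 2 +
        2 * w 0 * (A * z 0 + B * z 1 + l₀) + 2 * w 1 * (B * z 0 + C * z 1 + l₁) := by
      simp only [diagForm, Matrix.mulVec, dotProduct, Fin.sum_univ_two, Pi.add_apply, hA, hB, hC,
        hl₀, hl₁]
      ring
    rw [e, hz0, hz1]
    ring
  refine ⟨diagForm β z + diagForm β (δ + t.mulVec z),
    add_nonneg (diagForm_nonneg hβ _) (diagForm_nonneg hβ _), ?_, ?_, ?_⟩
  -- The value at the origin, `β(δ) / 2`, is at least the minimum `v / 2`.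
  · have h := key (-z)
    rw [neg_add_cancel, Matrix.mulVec_zero, add_zero] at h
    have h2 : diagForm β 0 = 0 := by simp [diagForm]
    rw [h2] at h
    have h3 : 0 ≤ A * (-z) 0 ^ 2 + 2 * B * (-z) 0 * (-z) 1 + C * (-z) 1 ^ 2 := by
      have e : A * (-z) 0 ^ 2 + 2 * B * (-z) 0 * (-z) 1 + C * (-z) 1 ^ 2 =
          (A * (-z) 0 + B * (-z) 1) ^ 2 / A + (A * C - B ^ 2) / A * (-z) 1 ^ 2 := by
        field_simp
        ring
      rw [e]
      positivity
    linarith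
  -- Write `δ = (δ + t z) - t z` and bound `β(t z)` by the weighted norm times `β(z)`.
  · have h := diagForm_sub_le hβ (δ + t.mulVec z) (t.mulVec z)
    rw [add_sub_cancel_right] at h
    have h2 := diagForm_mulVec_le hβ t z
    have h3 := weightedNormSq_nonneg hβ t
    have h4 := mul_nonneg h3 (diagForm_nonneg hβ (δ + t.mulVec z))
    have h5 := diagForm_nonneg hβ z
    nlinarith
  · rw [lintegral_columnDensity_rpow_half α hβ ht, ← hδ,
      ← lintegral_add_right_eq_self _ z]
    set v := diagForm β z + diagForm β (δ + t.mulVec z) with hv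
    have hsplit : ∀ w : Fin 2 → ℝ, ENNReal.ofReal
        (Real.exp (-((diagForm β (w + z) + diagForm β (δ + t.mulVec (w + z))) / 2))) =
        ENNReal.ofReal (Real.exp (-(A * w 0 ^ 2 + 2 * B * w 0 * w 1 + C * w 1 ^ 2))) *
          ENNReal.ofReal (Real.exp (-v / 2)) := by
      intro w
      rw [key w, ← ENNReal.ofReal_mul (Real.exp_pos _).le, ← Real.exp_add]
      congr 2
      ring
    simp_rw [hsplit]
    rw [lintegral_mul_const _ (by fun_prop), lintegral_exp_neg_quadratic hC0 hD0,
      ← ENNReal.ofReal_mul (by positivity), ← ENNReal.ofReal_mul (by positivity), hD,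
      Real.sqrt_mul (show 0 ≤ |t.det| * (β 0 * β 1) by positivity),
      Real.sqrt_div (Real.exp_pos _).le, Real.exp_half]
    congr 1
    have hs : Real.sqrt (|t.det| * (β 0 * β 1)) ≠ 0 := (Real.sqrt_pos.2 (by positivity)).ne'
    have hs' : Real.sqrt (1 + covDefect β t) ≠ 0 := (Real.sqrt_pos.2 (by positivity)).ne'
    have hpi := Real.pi_pos.ne'
    field_simp

end Affinity

/-! ### Products and series; passage from rows to columns -/

section Columns

theorem one_add_sum_le_prod_one_add {ι : Type*} {s : ι → ℝ} (hs : ∀ i, 0 ≤ s i)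
    (F : Finset ι) : 1 + ∑ i ∈ F, s i ≤ ∏ i ∈ F, (1 + s i) := by
  induction F using Finset.cons_induction with
  | empty => simp
  | cons j F hj ih =>
    rw [Finset.sum_cons, Finset.prod_cons]
    nlinarith [hs j, Finset.sum_nonneg fun i (_ : i ∈ F) ↦ hs i]

/-- The two bounds give `exp(-∑ s) ≤ (∏ H)² ≤ 1 / (1 + ∑ s)` over every finite set. -/
theorem iInf_prod_ofReal_eq_zero_iff {ι : Type*} {s H : ι → ℝ} (hs : ∀ i, 0 ≤ s i)
    (hH : ∀ i, 0 ≤ H i) (hl : ∀ i, Real.exp (-s i) ≤ H i ^ 2)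
    (hu : ∀ i, H i ^ 2 ≤ (1 + s i)⁻¹) :
    ⨅ F : Finset ι, ∏ i ∈ F, ENNReal.ofReal (H i) = 0 ↔ ∑' i, ENNReal.ofReal (s i) = ⊤ := by
  have hprod : ∀ F : Finset ι,
      ∏ i ∈ F, ENNReal.ofReal (H i) = ENNReal.ofReal (∏ i ∈ F, H i) := fun F ↦
    (ENNReal.ofReal_prod_of_nonneg fun i _ ↦ hH i).symm
  have hsum : ∀ F : Finset ι,
      ∑ i ∈ F, ENNReal.ofReal (s i) = ENNReal.ofReal (∑ i ∈ F, s i) := fun F ↦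
    (ENNReal.ofReal_sum_of_nonneg fun i _ ↦ hs i).symm
  constructor
  · intro h
    by_contra hne
    have hlow : ∀ F : Finset ι,
        ENNReal.ofReal (Real.exp (-(∑' i, ENNReal.ofReal (s i)).toReal / 2)) ≤
          ∏ i ∈ F, ENNReal.ofReal (H i) := by
      intro F
      rw [hprod]
      refine ENNReal.ofReal_le_ofReal ?_
      have h1 : ∑ i ∈ F, s i ≤ (∑' i, ENNReal.ofReal (s i)).toReal := by
        rw [← ENNReal.ofReal_le_iff_le_toReal hne, ← hsum]
        exact ENNReal.sum_le_tsum F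
      have h2 : Real.exp (-∑ i ∈ F, s i) ≤ (∏ i ∈ F, H i) ^ 2 := by
        rw [← Finset.sum_neg_distrib, Real.exp_sum, ← Finset.prod_pow]
        exact Finset.prod_le_prod (fun i _ ↦ (Real.exp_pos _).le) fun i _ ↦ hl i
      rw [Real.exp_half]
      refine Real.sqrt_le_iff.2 ⟨Finset.prod_nonneg fun i _ ↦ hH i, le_trans ?_ h2⟩
      exact Real.exp_le_exp.2 (neg_le_neg h1)
    have h3 := le_iInf hlow
    rw [h, nonpos_iff_eq_zero, ENNReal.ofReal_eq_zero] at h3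
    exact absurd h3 (not_le.2 (Real.exp_pos _))
  · intro h
    rw [← nonpos_iff_eq_zero]
    refine ENNReal.le_of_forall_pos_le_add fun ε hε _ ↦ ?_
    have hε' : (0 : ℝ) < ε := hε
    obtain ⟨F, hF⟩ : ∃ F : Finset ι,
        ENNReal.ofReal (((ε : ℝ) ^ 2)⁻¹) < ∑ i ∈ F, ENNReal.ofReal (s i) := by
      rw [ENNReal.tsum_eq_iSup_sum] at h
      exact lt_iSup_iff.1 (h ▸ ENNReal.ofReal_lt_top)
    rw [hsum] at hF
    have hF' : ((ε : ℝ) ^ 2)⁻¹ < ∑ i ∈ F, s i := (ENNReal.ofReal_lt_ofReal_iff_of_nonneg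
      (by positivity)).1 hF
    refine (iInf_le _ F).trans ?_
    rw [hprod, zero_add, ← ENNReal.ofReal_coe_nnreal]
    refine ENNReal.ofReal_le_ofReal (abs_le_of_sq_le_sq' ?_ hε'.le).2
    have h1 : 1 + ∑ i ∈ F, s i ≤ ∏ i ∈ F, (1 + s i) := one_add_sum_le_prod_one_add hs F
    calc (∏ i ∈ F, H i) ^ 2 = ∏ i ∈ F, H i ^ 2 := (Finset.prod_pow _ _ _).symm
      _ ≤ ∏ i ∈ F, (1 + s i)⁻¹ := Finset.prod_le_prod (fun i _ ↦ sq_nonneg _) fun i _ ↦ hu i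
      _ = (∏ i ∈ F, (1 + s i))⁻¹ := Finset.prod_inv_distrib _
      _ ≤ (((ε : ℝ) ^ 2)⁻¹)⁻¹ := by
        apply inv_anti₀ (by positivity)
        linarith
      _ = _ := inv_inv _

/-- Regard a matrix as its sequence of columns. -/
def columns : RowSpace 2 ≃ᵐ (ℤ → Fin 2 → ℝ) where
  toFun x n k := x k n
  invFun y k n := y n k
  left_inv _ := rfl
  right_inv _ := rfl
  measurable_toFun := by
    change Measurable fun (x : RowSpace 2) n k ↦ x k n
    fun_prop
  measurable_invFun := by
    change Measurable fun (y : ℤ → Fin 2 → ℝ) k n ↦ y n k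
    fun_prop

theorem mutuallySingular_map_iff {Ω Ω' : Type*} [MeasurableSpace Ω] [MeasurableSpace Ω']
    (e : Ω ≃ᵐ Ω') {m₁ m₂ : Measure Ω} :
    (m₁.map e).MutuallySingular (m₂.map e) ↔ m₁.MutuallySingular m₂ := by
  refine ⟨fun h ↦ ?_, fun h ↦ e.measurableEmbedding.mutuallySingular_map h⟩
  simpa using e.symm.measurableEmbedding.mutuallySingular_map h

/-- Both iterated products are curried forms of a single product over `Fin 2 × ℤ`, up to swapping
the factors. -/
theorem gaussMeasure_map_columns (b a : Fin 2 → ℤ → ℝ) :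
    (gaussMeasure b a).map columns =
      Measure.infinitePi fun n ↦ columnGauss (fun k ↦ b k n) (fun k ↦ a k n) := by
  have h1 := Measure.infinitePi_map_curry (fun (k : Fin 2) (n : ℤ) ↦ gauss (b k n) (a k n))
  have h2 := Measure.infinitePi_map_curry (fun (n : ℤ) (k : Fin 2) ↦ gauss (b k n) (a k n))
  have h3 := Measure.infinitePi_map_piCongrLeft
    (fun p : ℤ × Fin 2 ↦ gauss (b p.2 p.1) (a p.2 p.1)) (Equiv.prodComm (Fin 2) ℤ)
  have h4 : (Measure.infinitePi fun n ↦ columnGauss (fun k ↦ b k n) (fun k ↦ a k n)) =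
      Measure.infinitePi fun n ↦ Measure.infinitePi fun k ↦ gauss (b k n) (a k n) := by
    congr 1
    funext n
    exact (Measure.infinitePi_eq_pi _).symm
  have h5 : gaussMeasure b a =
      Measure.infinitePi fun k ↦ Measure.infinitePi fun n ↦ gauss (b k n) (a k n) :=
    (Measure.infinitePi_eq_pi _).symm
  rw [h4, h5, ← h1, ← h2, ← h3, Measure.map_map (by fun_prop) (by fun_prop),
    Measure.map_map (by fun_prop) (by fun_prop)]
  congr 1

theorem leftImage_map_columns (b a : Fin 2 → ℤ → ℝ) (t : Matrix (Fin 2) (Fin 2) ℝ) :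
    (leftImage (gaussMeasure b a) t).map columns = Measure.infinitePi fun n ↦
      (columnGauss (fun k ↦ b k n) (fun k ↦ a k n)).map t.mulVec := by
  rw [leftImage, Measure.map_map columns.measurable (measurable_leftMul t),
    ← Measure.infinitePi_map_pi _ (fun _ ↦ measurable_mulVec t), ← gaussMeasure_map_columns,
    Measure.map_map (by fun_prop) columns.measurable]
  rfl

end Columns

/-! ### The singularity criterion by two series -/

section Criterion

variable {b : Fin 2 → ℤ → ℝ} (a : Fin 2 → ℤ → ℝ)
  {t : Matrix (Fin 2) (Fin 2) ℝ}

/-- The covariance part of the distance between the Gaussian product measure and its image. -/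
noncomputable def covSeries (b : Fin 2 → ℤ → ℝ) (t : Matrix (Fin 2) (Fin 2) ℝ) : ℝ≥0∞ :=
  ∑' n, ENNReal.ofReal (covDefect (fun k ↦ b k n) t)

/-- The mean part of the distance between the Gaussian product measure and its image. -/
noncomputable def meanSeries (b a : Fin 2 → ℤ → ℝ) (t : Matrix (Fin 2) (Fin 2) ℝ) : ℝ≥0∞ :=
  ∑' n, ENNReal.ofReal
    (diagForm (fun k ↦ b k n) (t.mulVec (fun k ↦ a k n) - fun k ↦ a k n))

theorem weightedNormSq_le_of_covSeries_ne_top (ht : t.det ≠ 0) (h : covSeries b t ≠ ⊤) (n : ℤ) :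
    weightedNormSq (fun k ↦ b k n) t ≤ 4 * |t.det| * (1 + (covSeries b t).toReal) := by
  refine (weightedNormSq_le_covDefect ht).trans ?_
  have h1 : covDefect (fun k ↦ b k n) t ≤ (covSeries b t).toReal := by
    rw [← ENNReal.ofReal_le_iff_le_toReal h]
    exact ENNReal.le_tsum n
  gcongr

theorem tsum_ofReal_eq_top_of_le_mul {ι : Type*} {v w : ι → ℝ} {K : ℝ} (hK : 0 ≤ K)
    (h : ∀ i, w i ≤ K * v i) (hw : ∑' i, ENNReal.ofReal (w i) = ⊤) :
    ∑' i, ENNReal.ofReal (v i) = ⊤ := by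
  have h1 : ∑' i, ENNReal.ofReal (w i) ≤ ENNReal.ofReal K * ∑' i, ENNReal.ofReal (v i) := by
    rw [← ENNReal.tsum_mul_left]
    refine ENNReal.tsum_le_tsum fun i ↦ ?_
    rw [← ENNReal.ofReal_mul hK]
    exact ENNReal.ofReal_le_ofReal (h i)
  by_contra hne
  rw [hw, top_le_iff] at h1
  exact ENNReal.mul_ne_top ENNReal.ofReal_ne_top hne h1

/-- The image of the Gaussian product measure under an invertible `t` is singular to it if and
only if the covariance series or the mean series diverges. -/
theorem leftImage_mutuallySingular_iff (hb : ∀ k n, 0 < b k n) (ht : t.det ≠ 0) :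
    (leftImage (gaussMeasure b a) t).MutuallySingular (gaussMeasure b a) ↔
      covSeries b t = ⊤ ∨ meanSeries b a t = ⊤ := by
  have hprob : ∀ n, IsProbabilityMeasure
      ((columnGauss (fun k ↦ b k n) (fun k ↦ a k n)).map t.mulVec) := fun n ↦
    Measure.isProbabilityMeasure_map (measurable_mulVec t).aemeasurable
  choose v hv0 hvle hlev hv using fun n ↦
    exists_columnAffinity_eq (fun k ↦ hb k n) (fun k ↦ a k n) ht
  have hu : ∀ n, 0 ≤ covDefect (fun k ↦ b k n) t := fun n ↦
    covDefect_nonneg (fun k ↦ hb k n) ht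
  rw [← mutuallySingular_map_iff columns, leftImage_map_columns,
    gaussMeasure_map_columns, infinitePi_mutuallySingular_iff
      (fun n ↦ measurable_columnDensity (fun k ↦ b k n) (fun k ↦ a k n) t)
      (fun n ↦ columnGauss_eq_map_withDensity _ (fun k ↦ hb k n) ht)]
  simp_rw [hv]
  rw [iInf_prod_ofReal_eq_zero_iff (s := fun n ↦ covDefect (fun k ↦ b k n) t + v n)
    (fun n ↦ add_nonneg (hu n) (hv0 n)) (fun n ↦ Real.sqrt_nonneg _)]
  · have hsum : ∑' n, ENNReal.ofReal (covDefect (fun k ↦ b k n) t + v n) =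
        covSeries b t + ∑' n, ENNReal.ofReal (v n) := by
      rw [covSeries, ← ENNReal.tsum_add]
      exact tsum_congr fun n ↦ ENNReal.ofReal_add (hu n) (hv0 n)
    rw [hsum, ENNReal.add_eq_top]
    constructor
    · rintro (h | h)
      · exact Or.inl h
      · refine Or.inr (top_le_iff.1 (h ▸ ENNReal.tsum_le_tsum fun n ↦ ?_))
        exact ENNReal.ofReal_le_ofReal (hvle n)
    · rintro (h | h)
      · exact Or.inl h
      · by_cases hc : covSeries b t = ⊤
        · exact Or.inl hc
        -- A convergent covariance series bounds the weighted norm uniformly in `n`, so one constant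
        -- `K` serves all columns.
        · refine Or.inr (tsum_ofReal_eq_top_of_le_mul
            (K := 2 * (1 + 4 * |t.det| * (1 + (covSeries b t).toReal))) (by positivity)
            (fun n ↦ (hlev n).trans ?_) h)
          have := weightedNormSq_le_of_covSeries_ne_top ht hc n
          exact mul_le_mul_of_nonneg_right (by linarith) (hv0 n)
  -- Lower bound `exp(-(u + v)) ≤ exp(-v) / (1 + u)`, from `1 + u ≤ exp u`.
  · intro n
    have h1 := hu n
    have h2 := Real.add_one_le_exp (covDefect (fun k ↦ b k n) t)
    rw [Real.sq_sqrt (by positivity), neg_add, Real.exp_add, mul_comm, div_eq_mul_inv,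
      Real.exp_neg (covDefect _ _)]
    gcongr
    linarith
  -- Upper bound, from `(1 + u) exp v ≥ (1 + u)(1 + v) ≥ 1 + u + v`.
  · intro n
    have h1 := hu n
    have h2 := Real.add_one_le_exp (v n)
    have h3 := hv0 n
    rw [Real.sq_sqrt (by positivity), Real.exp_neg, inv_div_left]
    apply inv_anti₀ (by positivity)
    nlinarith

end Criterion

/-! ### The series for the five families -/

section Families

theorem tsum_ofReal_mul_left {ι : Type*} {c : ℝ} (hc : 0 ≤ c) (f : ι → ℝ) :
    ∑' i, ENNReal.ofReal (c * f i) = ENNReal.ofReal c * ∑' i, ENNReal.ofReal (f i) := by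
  simp_rw [ENNReal.ofReal_mul hc]
  exact ENNReal.tsum_mul_left

theorem ofReal_mul_eq_top_iff {c : ℝ} (hc : 0 < c) {x : ℝ≥0∞} :
    ENNReal.ofReal c * x = ⊤ ↔ x = ⊤ := by
  rw [ENNReal.mul_eq_top]
  simp [hc]

variable {b : Fin 2 → ℤ → ℝ} (a : Fin 2 → ℤ → ℝ)

theorem SL_eq_top_iff (hb : ∀ k n, 0 < b k n) (k n : Fin 2) :
    SL b a k n = ⊤ ↔ ∑' m, ENNReal.ofReal (b k m / b n m) = ⊤ ∨
      ∑' m, ENNReal.ofReal (b k m * a n m ^ 2) = ⊤ := by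
  have h : SL b a k n = ENNReal.ofReal (1 / 4) * ∑' m, ENNReal.ofReal (b k m / b n m) +
      ENNReal.ofReal (1 / 2) * ∑' m, ENNReal.ofReal (b k m * a n m ^ 2) := by
    rw [← tsum_ofReal_mul_left (by norm_num), ← tsum_ofReal_mul_left (by norm_num),
      ← ENNReal.tsum_add, SL]
    refine tsum_congr fun m ↦ ?_
    have h1 := hb k m
    have h2 := hb n m
    rw [← ENNReal.ofReal_add (by positivity) (by positivity)]
    congr 1
    field_simp
    ring
  rw [h, ENNReal.add_eq_top, ofReal_mul_eq_top_iff (by norm_num),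
    ofReal_mul_eq_top_iff (by norm_num)]

/-- At `t = 0` only the row's own means remain; this divergence settles the matrices outside the
five families whose covariance series converges. -/
theorem SLminus_zero_eq_top_iff (k n : Fin 2) :
    SLminus b a k n 0 = ⊤ ↔ ∑' m, ENNReal.ofReal (b k m * a k m ^ 2) = ⊤ := by
  have h : SLminus b a k n 0 =
      ENNReal.ofReal 2 * ∑' m, ENNReal.ofReal (b k m * a k m ^ 2) := by
    rw [← tsum_ofReal_mul_left (by norm_num), SLminus]
    simp only [ne_eq, OfNat.ofNat_ne_zero, not_false_eq_true, zero_pow, zero_div,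
      ENNReal.ofReal_zero, zero_mul, zero_add, add_zero]
    refine tsum_congr fun m ↦ ?_
    congr 1
    ring
  rw [h, ofReal_mul_eq_top_iff (by norm_num)]

theorem expE12_mutuallySingular_iff (hb : ∀ k n, 0 < b k n) {t : ℝ} (ht : t ≠ 0) :
    (leftImage (gaussMeasure b a) (expE12 t)).MutuallySingular (gaussMeasure b a) ↔
      SL b a 0 1 = ⊤ := by
  have hdet : (expE12 t).det = 1 := by simp [expE12, Matrix.det_fin_two]
  have hcov : covSeries b (expE12 t) =
      ENNReal.ofReal (t ^ 2 / 4) * ∑' m, ENNReal.ofReal (b 0 m / b 1 m) := by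
    rw [← tsum_ofReal_mul_left (by positivity), covSeries]
    refine tsum_congr fun m ↦ ?_
    rw [covDefect, hdet, weightedNormSq]
    congr 1
    simp [expE12]
    ring
  have hmean : meanSeries b a (expE12 t) =
      ENNReal.ofReal (t ^ 2) * ∑' m, ENNReal.ofReal (b 0 m * a 1 m ^ 2) := by
    rw [← tsum_ofReal_mul_left (by positivity), meanSeries]
    refine tsum_congr fun m ↦ ?_
    rw [diagForm]
    congr 1
    simp [expE12, dotProduct, Fin.sum_univ_two]
    ring
  rw [leftImage_mutuallySingular_iff a hb (by simp [hdet]), hcov, hmean, SL_eq_top_iff a hb,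
    ofReal_mul_eq_top_iff (by positivity), ofReal_mul_eq_top_iff (by positivity)]

theorem expE21_mutuallySingular_iff (hb : ∀ k n, 0 < b k n) {t : ℝ} (ht : t ≠ 0) :
    (leftImage (gaussMeasure b a) (expE21 t)).MutuallySingular (gaussMeasure b a) ↔
      SL b a 1 0 = ⊤ := by
  have hdet : (expE21 t).det = 1 := by simp [expE21, Matrix.det_fin_two]
  have hcov : covSeries b (expE21 t) =
      ENNReal.ofReal (t ^ 2 / 4) * ∑' m, ENNReal.ofReal (b 1 m / b 0 m) := by
    rw [← tsum_ofReal_mul_left (by positivity), covSeries]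
    refine tsum_congr fun m ↦ ?_
    rw [covDefect, hdet, weightedNormSq]
    congr 1
    simp [expE21]
    ring
  have hmean : meanSeries b a (expE21 t) =
      ENNReal.ofReal (t ^ 2) * ∑' m, ENNReal.ofReal (b 1 m * a 0 m ^ 2) := by
    rw [← tsum_ofReal_mul_left (by positivity), meanSeries]
    refine tsum_congr fun m ↦ ?_
    rw [diagForm]
    congr 1
    simp [expE21, dotProduct, Fin.sum_univ_two]
    ring
  rw [leftImage_mutuallySingular_iff a hb (by simp [hdet]), hcov, hmean, SL_eq_top_iff a hb,
    ofReal_mul_eq_top_iff (by positivity), ofReal_mul_eq_top_iff (by positivity)]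

theorem expE12_mul_P1 (t : ℝ) : expE12 t * P1 = !![-1, t; 0, 1] := by
  ext i j
  fin_cases i <;> fin_cases j <;> simp [expE12, P1, Matrix.mul_apply, Fin.sum_univ_two]

theorem expE21_mul_P2 (t : ℝ) : expE21 t * P2 = !![1, 0; t, -1] := by
  ext i j
  fin_cases i <;> fin_cases j <;> simp [expE21, P2, Matrix.mul_apply, Fin.sum_univ_two]

theorem expE12_mul_P1_mutuallySingular_iff (hb : ∀ k n, 0 < b k n) (t : ℝ) :
    (leftImage (gaussMeasure b a) (expE12 t * P1)).MutuallySingular (gaussMeasure b a) ↔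
      SLminus b a 0 1 t = ⊤ := by
  rw [expE12_mul_P1]
  have hdet : (!![-1, t; 0, 1] : Matrix (Fin 2) (Fin 2) ℝ).det = -1 := by
    simp [Matrix.det_fin_two]
  have hcov : covSeries b !![-1, t; 0, 1] =
      ENNReal.ofReal (t ^ 2 / 4) * ∑' m, ENNReal.ofReal (b 0 m / b 1 m) := by
    rw [← tsum_ofReal_mul_left (by positivity), covSeries]
    refine tsum_congr fun m ↦ ?_
    rw [covDefect, hdet, weightedNormSq]
    congr 1
    simp
    ring
  have hmean : ∑' m : ℤ, ENNReal.ofReal (b 0 m / 2 * (-2 * a 0 m + t * a 1 m) ^ 2) =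
      ENNReal.ofReal (1 / 2) * meanSeries b a !![-1, t; 0, 1] := by
    rw [meanSeries, ← tsum_ofReal_mul_left (by positivity)]
    refine tsum_congr fun m ↦ ?_
    rw [diagForm]
    congr 1
    simp [dotProduct, Fin.sum_univ_two]
    ring
  rw [leftImage_mutuallySingular_iff a hb (by simp [hdet]), SLminus, hmean, ENNReal.add_eq_top,
    ← hcov, ofReal_mul_eq_top_iff (by positivity)]

theorem expE21_mul_P2_mutuallySingular_iff (hb : ∀ k n, 0 < b k n) (t : ℝ) :
    (leftImage (gaussMeasure b a) (expE21 t * P2)).MutuallySingular (gaussMeasure b a) ↔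
      SLminus b a 1 0 t = ⊤ := by
  rw [expE21_mul_P2]
  have hdet : (!![1, 0; t, -1] : Matrix (Fin 2) (Fin 2) ℝ).det = -1 := by
    simp [Matrix.det_fin_two]
  have hcov : covSeries b !![1, 0; t, -1] =
      ENNReal.ofReal (t ^ 2 / 4) * ∑' m, ENNReal.ofReal (b 1 m / b 0 m) := by
    rw [← tsum_ofReal_mul_left (by positivity), covSeries]
    refine tsum_congr fun m ↦ ?_
    rw [covDefect, hdet, weightedNormSq]
    congr 1
    simp
    ring
  have hmean : ∑' m : ℤ, ENNReal.ofReal (b 1 m / 2 * (-2 * a 1 m + t * a 0 m) ^ 2) =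
      ENNReal.ofReal (1 / 2) * meanSeries b a !![1, 0; t, -1] := by
    rw [meanSeries, ← tsum_ofReal_mul_left (by positivity)]
    refine tsum_congr fun m ↦ ?_
    rw [diagForm]
    congr 1
    simp [dotProduct, Fin.sum_univ_two]
    ring
  rw [leftImage_mutuallySingular_iff a hb (by simp [hdet]), SLminus, hmean, ENNReal.add_eq_top,
    ← hcov, ofReal_mul_eq_top_iff (by positivity)]

theorem det_tauMinus {s : ℝ} (hs : 0 < s) (φ : ℝ) : (tauMinus φ s).det = -1 := by
  have h := Real.sin_sq_add_cos_sq φ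
  simp only [tauMinus, Matrix.det_fin_two, Matrix.of_apply, Matrix.cons_val', Matrix.cons_val_zero,
    Matrix.cons_val_one, Matrix.cons_val_fin_one]
  field_simp
  linarith

theorem tauMinus_mutuallySingular_iff (hb : ∀ k n, 0 < b k n) {s : ℝ} (hs : 0 < s) (φ : ℝ) :
    (leftImage (gaussMeasure b a) (tauMinus φ s)).MutuallySingular (gaussMeasure b a) ↔
      Sigma12minus b a φ s = ⊤ := by
  have hdet := det_tauMinus hs φ
  have hcov : ENNReal.ofReal (Real.sin φ ^ 2) * Sigma1 b s =
      ENNReal.ofReal 4 * covSeries b (tauMinus φ s) := by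
    rw [Sigma1, covSeries, ← tsum_ofReal_mul_left (by positivity),
      ← tsum_ofReal_mul_left (by positivity)]
    refine tsum_congr fun m ↦ ?_
    have h0 := hb 0 m
    have h1 := hb 1 m
    rw [covDefect, hdet, weightedNormSq]
    congr 1
    have hr : Real.sqrt (b 0 m / b 1 m) * Real.sqrt (b 1 m / b 0 m) = 1 := by
      rw [← Real.sqrt_mul (by positivity), div_mul_div_cancel₀ h1.ne', div_self h0.ne',
        Real.sqrt_one]
    have e : (s ^ 2 * Real.sqrt (b 0 m / b 1 m) - (s ^ 2)⁻¹ * Real.sqrt (b 1 m / b 0 m)) ^ 2 =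
        s ^ 4 * (b 0 m / b 1 m) + (s ^ 4)⁻¹ * (b 1 m / b 0 m) - 2 := by
      have e1 := Real.sq_sqrt (show 0 ≤ b 0 m / b 1 m by positivity)
      have e2 := Real.sq_sqrt (show 0 ≤ b 1 m / b 0 m by positivity)
      have e3 : s ^ 2 * (s ^ 2)⁻¹ = 1 := mul_inv_cancel₀ (by positivity)
      calc _ = s ^ 4 * Real.sqrt (b 0 m / b 1 m) ^ 2 +
            (s ^ 4)⁻¹ * Real.sqrt (b 1 m / b 0 m) ^ 2 - 2 * (s ^ 2 * (s ^ 2)⁻¹) *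
            (Real.sqrt (b 0 m / b 1 m) * Real.sqrt (b 1 m / b 0 m)) := by ring
        _ = _ := by rw [e1, e2, e3, hr]; ring
    rw [e]
    have hc := Real.cos_sq' φ
    simp only [tauMinus, Matrix.of_apply, Matrix.cons_val', Matrix.cons_val_zero,
      Matrix.cons_val_one, Matrix.cons_val_fin_one, neg_sq, mul_pow, hc, abs_neg, abs_one]
    ring
  have hmean : Sigma2minus b a φ s = meanSeries b a (tauMinus φ s) := by
    rw [Sigma2minus, meanSeries]
    refine tsum_congr fun m ↦ ?_
    rw [diagForm]
    congr 1
    have hsin : Real.sin φ = 2 * Real.sin (φ / 2) * Real.cos (φ / 2) := by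
      rw [← Real.sin_two_mul]; congr 1; ring
    have hcos : Real.cos φ = 1 - 2 * Real.sin (φ / 2) ^ 2 := by
      have h := Real.cos_two_mul (φ / 2)
      rw [mul_div_cancel₀ φ two_ne_zero] at h
      rw [h, Real.cos_sq']; ring
    have hcos' : Real.cos φ = 2 * Real.cos (φ / 2) ^ 2 - 1 := by
      have h := Real.cos_two_mul (φ / 2)
      rwa [mul_div_cancel₀ φ two_ne_zero] at h
    -- `τ₋` is a reflection, so `τ₋ - 1` has rank one: in half angles both coordinates of the
    -- displacement are multiples of the same linear form in the means.
    have d0 : ((tauMinus φ s).mulVec (fun k ↦ a k m) - fun k ↦ a k m) 0 =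
        -2 * Real.sin (φ / 2) * (Real.sin (φ / 2) * a 0 m - s ^ 2 * Real.cos (φ / 2) * a 1 m) := by
      simp [tauMinus, dotProduct, Fin.sum_univ_two]
      rw [hsin, hcos]; ring
    have d1 : ((tauMinus φ s).mulVec (fun k ↦ a k m) - fun k ↦ a k m) 1 =
        2 * (s ^ 2)⁻¹ * Real.cos (φ / 2) *
          (Real.sin (φ / 2) * a 0 m - s ^ 2 * Real.cos (φ / 2) * a 1 m) := by
      simp [tauMinus, dotProduct, Fin.sum_univ_two]
      rw [hsin, hcos']; field_simp; ring
    rw [d0, d1]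
    ring
  rw [leftImage_mutuallySingular_iff a hb (by simp [hdet]), Sigma12minus, hcov, hmean,
    ENNReal.add_eq_top, ofReal_mul_eq_top_iff (by positivity)]

end Families

/-! ### Reduction of a general invertible matrix to the families -/

section GeneralLinear

variable {b : Fin 2 → ℤ → ℝ} (a : Fin 2 → ℤ → ℝ) {t : Matrix (Fin 2) (Fin 2) ℝ}

theorem covSeries_eq_top_of_le {c : ℝ} (hc : 0 < c)
    (h : ∀ n, c ≤ covDefect (fun k ↦ b k n) t) : covSeries b t = ⊤ := by
  rw [covSeries, ← top_le_iff, ← ENNReal.tsum_const_eq_top_of_ne_zero (α := ℤ)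
    (c := ENNReal.ofReal c) (by simpa using hc)]
  exact ENNReal.tsum_le_tsum fun n ↦ ENNReal.ofReal_le_ofReal (h n)

/-- The determinant relation turns `4 u`, the weighted norm minus `2`, into a sum of squares, which
isolates the difference of the diagonal entries. -/
theorem covDefect_of_det_eq_one (hb : ∀ k n, 0 < b k n) (ht : t.det = 1) (n : ℤ) :
    covDefect (fun k ↦ b k n) t = ((t 0 0 - t 1 1) ^ 2 +
      (b 0 n * t 0 1 + b 1 n * t 1 0) ^ 2 / (b 0 n * b 1 n)) / 4 := by
  have h0 := hb 0 n
  have h1 := hb 1 n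
  have hd := ht
  rw [Matrix.det_fin_two] at hd
  have e : (b 0 n * t 0 1 + b 1 n * t 1 0) ^ 2 / (b 0 n * b 1 n) =
      t 0 1 ^ 2 * (b 0 n / b 1 n) + t 1 0 ^ 2 * (b 1 n / b 0 n) + 2 * (t 0 1 * t 1 0) := by
    field_simp; ring
  rw [covDefect, weightedNormSq, ht, e, abs_one]
  linear_combination (1 / 2 : ℝ) * hd

theorem covDefect_of_det_eq_neg_one (hb : ∀ k n, 0 < b k n) (ht : t.det = -1) (n : ℤ) :
    covDefect (fun k ↦ b k n) t = ((t 0 0 + t 1 1) ^ 2 +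
      (b 0 n * t 0 1 - b 1 n * t 1 0) ^ 2 / (b 0 n * b 1 n)) / 4 := by
  have h0 := hb 0 n
  have h1 := hb 1 n
  have hd := ht
  rw [Matrix.det_fin_two] at hd
  have e : (b 0 n * t 0 1 - b 1 n * t 1 0) ^ 2 / (b 0 n * b 1 n) =
      t 0 1 ^ 2 * (b 0 n / b 1 n) + t 1 0 ^ 2 * (b 1 n / b 0 n) - 2 * (t 0 1 * t 1 0) := by
    field_simp; ring
  rw [covDefect, weightedNormSq, ht, e, abs_neg, abs_one]
  linear_combination (-1 / 2 : ℝ) * hd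

/-- If `t` has no nonzero fixed vector, the mean series dominates `∑ b_{1n} a_{1n}²`. -/
theorem meanSeries_eq_top_of_det_sub_one_ne_zero (hb : ∀ k n, 0 < b k n) (ht : t.det ≠ 0)
    (hc : covSeries b t ≠ ⊤) (hD : (t - 1).det ≠ 0)
    (h : ∑' m, ENNReal.ofReal (b 0 m * a 0 m ^ 2) = ⊤) : meanSeries b a t = ⊤ := by
  set D := (t - 1).det with hDdef
  set K := 4 * |t.det| * (1 + (covSeries b t).toReal) with hK
  have hK0 : 0 ≤ K := by positivity
  refine tsum_ofReal_eq_top_of_le_mul (K := 2 * ((t 1 1 - 1) ^ 2 + K) / D ^ 2) (by positivity)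
    (fun n ↦ ?_) h
  have h0 := hb 0 n
  have h1 := hb 1 n
  have hN := weightedNormSq_le_of_covSeries_ne_top ht hc n
  -- This lets the weight `b 0 n` on the second displacement coordinate be exchanged for `b 1 n`.
  have hq : t 0 1 ^ 2 * b 0 n ≤ K * b 1 n := by
    have : t 0 1 ^ 2 * (b 0 n / b 1 n) ≤ K := by
      refine le_trans ?_ hN
      unfold weightedNormSq
      have : 0 ≤ t 0 0 ^ 2 + t 1 1 ^ 2 + t 1 0 ^ 2 * (b 1 n / b 0 n) := by positivity
      linarith
    rwa [← mul_div_assoc, div_le_iff₀ h1] at this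
  set x := (t.mulVec (fun k ↦ a k n) - fun k ↦ a k n) 0 with hx
  set y := (t.mulVec (fun k ↦ a k n) - fun k ↦ a k n) 1 with hy
  -- Cramer's rule recovers the mean from its displacement `(x, y) = (t - 1) a`.
  have hDa : D * a 0 n = (t 1 1 - 1) * x - t 0 1 * y := by
    simp [hx, hy, hDdef, Matrix.det_fin_two]
    ring
  have hform : diagForm (fun k ↦ b k n) (t.mulVec (fun k ↦ a k n) - fun k ↦ a k n) =
      b 0 n * x ^ 2 + b 1 n * y ^ 2 := rfl
  rw [hform, div_mul_eq_mul_div, le_div_iff₀ (by positivity)]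
  have e1 : b 0 n * a 0 n ^ 2 * D ^ 2 = b 0 n * ((t 1 1 - 1) * x - t 0 1 * y) ^ 2 := by
    rw [← hDa]; ring
  have e2 : ((t 1 1 - 1) * x - t 0 1 * y) ^ 2 ≤
      2 * ((t 1 1 - 1) ^ 2 * x ^ 2) + 2 * (t 0 1 ^ 2 * y ^ 2) := by
    nlinarith [sq_nonneg ((t 1 1 - 1) * x + t 0 1 * y)]
  have e3 := mul_le_mul_of_nonneg_left e2 h0.le
  have e4 := mul_le_mul_of_nonneg_right hq (sq_nonneg y)
  have e5 : 0 ≤ (t 1 1 - 1) ^ 2 * (b 1 n * y ^ 2) := by positivity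
  have e6 : 0 ≤ K * (b 0 n * x ^ 2) := by positivity
  rw [e1]
  linarith

/-- Necessarily `s² = σ = √(q / r)` and `cos φ = p`, with `|p| < 1` because `q r > 0`; the sign of
`q` decides between `arccos p` and `2π - arccos p`. -/
theorem exists_eq_tauMinus {p q r : ℝ} (hqr : 0 < q * r) (hd : p ^ 2 + q * r = 1) :
    ∃ s : ℝ, 0 < s ∧ ∃ φ ∈ Set.Ico 0 (2 * Real.pi), !![p, q; r, -p] = tauMinus φ s := by
  have hr : r ≠ 0 := right_ne_zero_of_mul hqr.ne'
  have hq : q ≠ 0 := left_ne_zero_of_mul hqr.ne'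
  have hdiv : 0 < q / r := by
    rw [show q / r = q * r / r ^ 2 by field_simp]; positivity
  set σ := Real.sqrt (q / r) with hσ
  have hσ0 : 0 < σ := Real.sqrt_pos.2 hdiv
  have hσ2 : σ ^ 2 = q / r := Real.sq_sqrt hdiv.le
  have hp1 : p < 1 := by nlinarith
  have hp2 : -1 < p := by nlinarith
  obtain ⟨φ, hφ, hcos, hsin⟩ : ∃ φ ∈ Set.Ico 0 (2 * Real.pi),
      Real.cos φ = p ∧ σ * Real.sin φ = q := by
    have hpi := Real.pi_pos
    have h1 := Real.arccos_pos.2 hp1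
    have h2 := Real.arccos_le_pi p
    have h3 := Real.cos_arccos hp2.le hp1.le
    have h4 : σ * Real.sqrt (1 - p ^ 2) = |q| := by
      rw [hσ, ← Real.sqrt_mul hdiv.le, ← Real.sqrt_sq_eq_abs, ← hd, add_sub_cancel_left]
      congr 1
      field_simp
    rcases lt_or_gt_of_ne hq with h | h
    · refine ⟨2 * Real.pi - Real.arccos p, ⟨by linarith, by linarith⟩, ?_, ?_⟩
      · rw [Real.cos_two_pi_sub, h3]
      · rw [Real.sin_two_pi_sub, Real.sin_arccos, mul_neg, h4, abs_of_neg h, neg_neg]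
    · refine ⟨Real.arccos p, ⟨h1.le, by linarith⟩, h3, ?_⟩
      rw [Real.sin_arccos, h4, abs_of_pos h]
  refine ⟨Real.sqrt σ, Real.sqrt_pos.2 hσ0, φ, hφ, ?_⟩
  have hr' : σ⁻¹ * Real.sin φ = r := by
    have : σ ^ 2 * r = q := by rw [hσ2]; field_simp
    rw [← hsin] at this
    field_simp
    have h5 : σ * (σ * r) = σ * Real.sin φ := by rw [← this]; ring
    exact (mul_left_cancel₀ hσ0.ne' h5).symm
  rw [tauMinus, Real.sq_sqrt hσ0.le, hcos, hsin, hr']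

theorem leftImage_mutuallySingular_of_ne_one (hb : ∀ k n, 0 < b k n)
    (h01 : SL b a 0 1 = ⊤) (h10 : SL b a 1 0 = ⊤) (hm01 : ∀ t : ℝ, SLminus b a 0 1 t = ⊤)
    (hm10 : ∀ t : ℝ, SLminus b a 1 0 t = ⊤)
    (hτ : ∀ s : ℝ, 0 < s → ∀ φ ∈ Set.Ico 0 (2 * Real.pi), Sigma12minus b a φ s = ⊤)
    (ht : t.det ≠ 0) (ht1 : t ≠ 1) :
    (leftImage (gaussMeasure b a) t).MutuallySingular (gaussMeasure b a) := by
  by_contra hns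
  have hiff := leftImage_mutuallySingular_iff a hb ht
  obtain ⟨hc, hm⟩ : covSeries b t ≠ ⊤ ∧ meanSeries b a t ≠ ⊤ := by
    rw [hiff, not_or] at hns
    exact hns
  have hrow0 := (SLminus_zero_eq_top_iff a 0 1).1 (hm01 0)
  have hrow1 := (SLminus_zero_eq_top_iff a 1 0).1 (hm10 0)
  have hdabs : |t.det| = 1 := by
    by_contra hne
    have h1 : (1 - |t.det|) ^ 2 ≠ 0 := pow_ne_zero _ (sub_ne_zero.2 (Ne.symm hne))
    have h2 : 0 < |t.det| := abs_pos.2 ht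
    exact hc (covSeries_eq_top_of_le (c := (1 - |t.det|) ^ 2 / (4 * |t.det|)) (by positivity)
      fun n ↦ sq_one_sub_abs_det_le_covDefect (fun k ↦ hb k n) ht)
  have heta : t = !![t 0 0, t 0 1; t 1 0, t 1 1] := Matrix.eta_fin_two t
  rcases (abs_eq zero_le_one).1 hdabs with hd | hd
  · have hdiag : t 0 0 = t 1 1 := by
      by_contra hne
      have h1 : (t 0 0 - t 1 1) ^ 2 ≠ 0 := pow_ne_zero _ (sub_ne_zero.2 hne)
      refine hc (covSeries_eq_top_of_le (c := (t 0 0 - t 1 1) ^ 2 / 4) (by positivity) fun n ↦ ?_)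
      have h2 := hb 0 n
      have h3 := hb 1 n
      rw [covDefect_of_det_eq_one hb hd]
      have : 0 ≤ (b 0 n * t 0 1 + b 1 n * t 1 0) ^ 2 / (b 0 n * b 1 n) := by positivity
      linarith
    have hd' := hd
    rw [Matrix.det_fin_two, hdiag] at hd'
    by_cases hp : t 1 1 = 1
    · have hqr : t 0 1 * t 1 0 = 0 := by rw [hp] at hd'; linarith
      rw [hdiag, hp] at heta
      by_cases hq : t 0 1 = 0
      · by_cases hr : t 1 0 = 0
        · refine ht1 (heta.trans ?_)
          rw [hq, hr, Matrix.one_fin_two]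
        · rw [hq] at heta
          refine hns ?_
          rw [heta]
          exact (expE21_mutuallySingular_iff a hb hr).2 h10
      · rw [(mul_eq_zero.1 hqr).resolve_left hq] at heta
        refine hns ?_
        rw [heta]
        exact (expE12_mutuallySingular_iff a hb hq).2 h01
    -- Here `det (t - 1) = 2 - tr t` is nonzero, so `t` fixes no nonzero vector.
    · refine hm (meanSeries_eq_top_of_det_sub_one_ne_zero a hb ht hc ?_ hrow0)
      have e : (t - 1).det = 2 * (1 - t 1 1) := by
        simp [Matrix.det_fin_two, hdiag]
        linarith
      rw [e]
      exact mul_ne_zero two_ne_zero (sub_ne_zero.2 (Ne.symm hp))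
  · have hdiag : t 1 1 = -t 0 0 := by
      by_contra hne
      have h1 : (t 0 0 + t 1 1) ^ 2 ≠ 0 :=
        pow_ne_zero _ fun h ↦ hne (by linarith)
      refine hc (covSeries_eq_top_of_le (c := (t 0 0 + t 1 1) ^ 2 / 4) (by positivity) fun n ↦ ?_)
      have h2 := hb 0 n
      have h3 := hb 1 n
      rw [covDefect_of_det_eq_neg_one hb hd]
      have : 0 ≤ (b 0 n * t 0 1 - b 1 n * t 1 0) ^ 2 / (b 0 n * b 1 n) := by positivity
      linarith
    have hd' : t 0 0 ^ 2 + t 0 1 * t 1 0 = 1 := by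
      rw [Matrix.det_fin_two, hdiag] at hd; linarith
    rw [hdiag] at heta
    rcases lt_trichotomy (t 0 1 * t 1 0) 0 with hqr | hqr | hqr
    -- For `q = t 0 1` and `r = t 1 0` of opposite signs, `(b₁ q - b₂ r)² ≥ -4 b₁ b₂ q r`.
    · refine hc (covSeries_eq_top_of_le (c := -(t 0 1 * t 1 0)) (by linarith) fun n ↦ ?_)
      have h2 := hb 0 n
      have h3 := hb 1 n
      rw [covDefect_of_det_eq_neg_one hb hd, le_div_iff₀ (by norm_num)]
      refine le_trans ?_ (le_add_of_nonneg_left (sq_nonneg _))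
      rw [le_div_iff₀ (by positivity)]
      nlinarith [sq_nonneg (b 0 n * t 0 1 + b 1 n * t 1 0)]
    · have hp : t 0 0 = 1 ∨ t 0 0 = -1 := by
        rw [hqr, add_zero] at hd'
        exact mul_self_eq_one_iff.1 (by rwa [← sq])
      rcases mul_eq_zero.1 hqr with hq | hr
      · rcases hp with hp | hp
        · refine hns ?_
          rw [heta, hp, hq, ← expE21_mul_P2]
          exact (expE21_mul_P2_mutuallySingular_iff a hb _).2 (hm10 _)
        -- The first displacement coordinate is `-2 a 0 n`, so each term is at least `4 b 0 n * a 0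
        -- n ^ 2`; the case `r = 0`, `p = 1` is symmetric, with the second row.
        · refine hm (tsum_ofReal_eq_top_of_le_mul (K := 1) zero_le_one (fun n ↦ ?_) hrow0)
          have h2 := hb 0 n
          have h3 := hb 1 n
          simp only [diagForm, Matrix.mulVec, dotProduct, Fin.sum_univ_two, Pi.sub_apply, hp, hq]
          have := mul_nonneg h3.le (sq_nonneg (t 1 0 * a 0 n + t 1 1 * a 1 n - a 1 n))
          have := mul_nonneg h2.le (sq_nonneg (a 0 n))
          linarith
      · rcases hp with hp | hp
        · refine hm (tsum_ofReal_eq_top_of_le_mul (K := 1) zero_le_one (fun n ↦ ?_) hrow1)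
          have h2 := hb 0 n
          have h3 := hb 1 n
          simp only [diagForm, Matrix.mulVec, dotProduct, Fin.sum_univ_two, Pi.sub_apply, hr,
            hdiag, hp]
          have := mul_nonneg h2.le (sq_nonneg (1 * a 0 n + t 0 1 * a 1 n - a 0 n))
          have := mul_nonneg h3.le (sq_nonneg (a 1 n))
          linarith
        · refine hns ?_
          rw [heta, hp, hr, neg_neg, ← expE12_mul_P1]
          exact (expE12_mul_P1_mutuallySingular_iff a hb _).2 (hm01 _)
    · obtain ⟨s, hs, φ, hφ, h⟩ := exists_eq_tauMinus hqr hd'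
      refine hns ?_
      rw [heta, h]
      exact (tauMinus_mutuallySingular_iff a hb hs φ).2 (hτ s hs φ hφ)

theorem mutuallySingular_of_forall_generalLinearGroup {μ : Measure (RowSpace 2)}
    (h : ∀ t : Matrix.GeneralLinearGroup (Fin 2) ℝ, t ≠ 1 →
      (leftImage μ (t : Matrix (Fin 2) (Fin 2) ℝ)).MutuallySingular μ)
    (ht : t.det ≠ 0) (ht1 : t ≠ 1) : (leftImage μ t).MutuallySingular μ :=
  h (Matrix.GeneralLinearGroup.mkOfDetNeZero t ht) fun hc ↦ ht1 (congrArg Units.val hc)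

end GeneralLinear

end GaussLeft

/-! ### The equivalences -/

theorem mainTheorem3 (b a : Fin 2 → ℤ → ℝ) (hb : ∀ k n, 0 < b k n)
    (μ : Measure (GaussLeft.RowSpace 2)) (hμ : μ = GaussLeft.gaussMeasure b a) :
    -- (i) ⇔ (ii) ⇔ (iii)
    [ (∀ t : Matrix.GeneralLinearGroup (Fin 2) ℝ, t ≠ 1 →
        (GaussLeft.leftImage μ (t : Matrix (Fin 2) (Fin 2) ℝ)).MutuallySingular μ),
      ((∀ t : ℝ, t ≠ 0 → (GaussLeft.leftImage μ (GaussLeft.expE12 t)).MutuallySingular μ) ∧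
        (∀ t : ℝ, t ≠ 0 → (GaussLeft.leftImage μ (GaussLeft.expE21 t)).MutuallySingular μ) ∧
        (∀ t : ℝ, (GaussLeft.leftImage μ
          (GaussLeft.expE12 t * GaussLeft.P1)).MutuallySingular μ) ∧
        (∀ t : ℝ, (GaussLeft.leftImage μ
          (GaussLeft.expE21 t * GaussLeft.P2)).MutuallySingular μ) ∧
        (∀ s : ℝ, 0 < s → ∀ φ ∈ Set.Ico 0 (2 * Real.pi),
          (GaussLeft.leftImage μ (GaussLeft.tauMinus φ s)).MutuallySingular μ)),
      (GaussLeft.SL b a 0 1 = ⊤ ∧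
        GaussLeft.SL b a 1 0 = ⊤ ∧
        (∀ t : ℝ, GaussLeft.SLminus b a 0 1 t = ⊤) ∧
        (∀ t : ℝ, GaussLeft.SLminus b a 1 0 t = ⊤) ∧
        (∀ s : ℝ, 0 < s → ∀ φ ∈ Set.Ico 0 (2 * Real.pi),
          GaussLeft.Sigma12minus b a φ s = ⊤)) ].TFAE ∧
    -- (ii)(♯) ⇔ (iii)(♯) for each family
    ((∀ t : ℝ, t ≠ 0 → (GaussLeft.leftImage μ (GaussLeft.expE12 t)).MutuallySingular μ) ↔
      GaussLeft.SL b a 0 1 = ⊤) ∧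
    ((∀ t : ℝ, t ≠ 0 → (GaussLeft.leftImage μ (GaussLeft.expE21 t)).MutuallySingular μ) ↔
      GaussLeft.SL b a 1 0 = ⊤) ∧
    ((∀ t : ℝ, (GaussLeft.leftImage μ
        (GaussLeft.expE12 t * GaussLeft.P1)).MutuallySingular μ) ↔
      ∀ t : ℝ, GaussLeft.SLminus b a 0 1 t = ⊤) ∧
    ((∀ t : ℝ, (GaussLeft.leftImage μ
        (GaussLeft.expE21 t * GaussLeft.P2)).MutuallySingular μ) ↔
      ∀ t : ℝ, GaussLeft.SLminus b a 1 0 t = ⊤) ∧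
    ((∀ s : ℝ, 0 < s → ∀ φ ∈ Set.Ico 0 (2 * Real.pi),
        (GaussLeft.leftImage μ (GaussLeft.tauMinus φ s)).MutuallySingular μ) ↔
      ∀ s : ℝ, 0 < s → ∀ φ ∈ Set.Ico 0 (2 * Real.pi),
        GaussLeft.Sigma12minus b a φ s = ⊤) ∧
    -- the same for each single parameter value
    (∀ t : ℝ, t ≠ 0 → ((GaussLeft.leftImage μ (GaussLeft.expE12 t)).MutuallySingular μ ↔
      GaussLeft.SL b a 0 1 = ⊤)) ∧
    (∀ t : ℝ, t ≠ 0 → ((GaussLeft.leftImage μ (GaussLeft.expE21 t)).MutuallySingular μ ↔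
      GaussLeft.SL b a 1 0 = ⊤)) ∧
    (∀ t : ℝ, (GaussLeft.leftImage μ
        (GaussLeft.expE12 t * GaussLeft.P1)).MutuallySingular μ ↔
      GaussLeft.SLminus b a 0 1 t = ⊤) ∧
    (∀ t : ℝ, (GaussLeft.leftImage μ
        (GaussLeft.expE21 t * GaussLeft.P2)).MutuallySingular μ ↔
      GaussLeft.SLminus b a 1 0 t = ⊤) ∧
    (∀ s : ℝ, 0 < s → ∀ φ ∈ Set.Ico 0 (2 * Real.pi),
      ((GaussLeft.leftImage μ (GaussLeft.tauMinus φ s)).MutuallySingular μ ↔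
        GaussLeft.Sigma12minus b a φ s = ⊤)) := by
  subst hμ
  have ha : ∀ t : ℝ, t ≠ 0 → _ := fun t ht ↦ GaussLeft.expE12_mutuallySingular_iff a hb ht
  have hb' : ∀ t : ℝ, t ≠ 0 → _ := fun t ht ↦ GaussLeft.expE21_mutuallySingular_iff a hb ht
  have hc : ∀ t : ℝ, _ := fun t ↦ GaussLeft.expE12_mul_P1_mutuallySingular_iff a hb t
  have hd : ∀ t : ℝ, _ := fun t ↦ GaussLeft.expE21_mul_P2_mutuallySingular_iff a hb t
  have he : ∀ s : ℝ, 0 < s → ∀ φ ∈ Set.Ico 0 (2 * Real.pi), _ := fun s hs φ _ ↦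
    GaussLeft.tauMinus_mutuallySingular_iff a hb hs φ
  -- The right side does not involve `t`, so the single value `t = 1` already gives it.
  have hA := (⟨fun h ↦ (ha 1 one_ne_zero).1 (h 1 one_ne_zero), fun h t ht ↦ (ha t ht).2 h⟩ :
    (∀ t : ℝ, t ≠ 0 → (GaussLeft.leftImage (GaussLeft.gaussMeasure b a)
      (GaussLeft.expE12 t)).MutuallySingular (GaussLeft.gaussMeasure b a)) ↔
      GaussLeft.SL b a 0 1 = ⊤)
  have hB := (⟨fun h ↦ (hb' 1 one_ne_zero).1 (h 1 one_ne_zero), fun h t ht ↦ (hb' t ht).2 h⟩ :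
    (∀ t : ℝ, t ≠ 0 → (GaussLeft.leftImage (GaussLeft.gaussMeasure b a)
      (GaussLeft.expE21 t)).MutuallySingular (GaussLeft.gaussMeasure b a)) ↔
      GaussLeft.SL b a 1 0 = ⊤)
  have hC := forall_congr' hc
  have hD := forall_congr' hd
  have hE := forall_congr' fun s ↦ forall_congr' fun hs ↦ forall_congr' fun φ ↦
    forall_congr' fun hφ ↦ he s hs φ hφ
  refine ⟨?_, hA, hB, hC, hD, hE, ha, hb', hc, hd, he⟩
  tfae_have 2 ↔ 3 := and_congr hA (and_congr hB (and_congr hC (and_congr hD hE)))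
  tfae_have 3 → 1 := fun ⟨h₁, h₂, h₃, h₄, h₅⟩ t ht ↦
    GaussLeft.leftImage_mutuallySingular_of_ne_one a hb h₁ h₂ h₃ h₄ h₅
      (Matrix.GeneralLinearGroup.det_ne_zero t) fun h ↦ ht (Units.ext h)
  tfae_have 1 → 2 := by
    intro h
    have hne : ∀ t : Matrix (Fin 2) (Fin 2) ℝ, t.det = -1 →
        (GaussLeft.leftImage (GaussLeft.gaussMeasure b a) t).MutuallySingular
          (GaussLeft.gaussMeasure b a) := fun t ht ↦
      GaussLeft.mutuallySingular_of_forall_generalLinearGroup h (by simp [ht]) fun h1 ↦ by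
        rw [h1, Matrix.det_one] at ht
        norm_num at ht
    refine ⟨fun t ht ↦ GaussLeft.mutuallySingular_of_forall_generalLinearGroup h
        (by simp [GaussLeft.expE12]) fun h1 ↦ ht ?_,
      fun t ht ↦ GaussLeft.mutuallySingular_of_forall_generalLinearGroup h
        (by simp [GaussLeft.expE21]) fun h1 ↦ ht ?_,
      fun t ↦ hne _ (by simp [GaussLeft.expE12_mul_P1]),
      fun t ↦ hne _ (by simp [GaussLeft.expE21_mul_P2]),
      fun s hs φ _ ↦ hne _ (GaussLeft.det_tauMinus hs φ)⟩
    · simpa [GaussLeft.expE12] using congrFun (congrFun h1 0) 1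
    · simpa [GaussLeft.expE21] using congrFun (congrFun h1 1) 0
  tfae_finish
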